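/- **Setting.** A polytope $P\subset\mathbb R^d$ is the convex hull of a finite set; its faces are the maximal loci of linear functionals on $P$. For a polytope $F$, $\mathrm{Lin}\,F$ is the linear span of the differences of points of $F$, $\dim F=\dim\mathrm{Lin}\,F$, and a facet of $F$ is a nonempty face of $F$ of dimension $\dim F-1$. For an ordered basis (frame) $(v_1,\dots,v_d)$ of $\mathbb R^d$ let $V_k=\mathrm{span}(v_1,\dots,v_k)$ and let $\pi_k\colon\mathbb R^d\to V_k$ be the projection fixing $v_1,\dots,v_k$ and killing $v_{k+1},\dots,v_d$. A *framed polytope* is a polytope $P$ with a frame such that for every $k\ge 0$ and every $k$-face $F$ of $P$ the map $\pi_k\colon \mathrm{Lin}\,F\to V_k$ is an isomorphism; let $\sigma^F$ be its inverse. The $k$-face $F$ is oriented by $\beta_F=\sigma^F(v_1)\wedge\dots\wedge\sigma^F(v_k)$ (with $\beta_F=1$ if $k=0$). A facet $E$ of $F$ lies in the source $s(F)$ (resp. target $t(F)$) if there are $v\in\mathrm{Lin}\,F$ and a functional $\psi$ whose maximal locus on $F$ is $E$, with $\psi(v)<0$ (resp. $\psi(v)>0$), such that $\beta_F$ is a positive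 multiple of $\beta_E\wedge v$. For $k<\dim F$, let $s_k(F)$ (resp. $t_k(F)$) be the set of $k$-faces $E$ of $F$ such that $\pi_{k+1}(E)$ is a facet of $\pi_{k+1}(F)$ lying in the source (resp. target) of $\pi_{k+1}(F)$, the latter being framed by $(v_1,\dots,v_{k+1})$. A *cellular $k$-string* is a sequence $F_1,\dots,F_m$ of faces of $P$ of dimension $>k$ with $t_k(F_i)\cap s_k(F_{i+1})\ne\emptyset$ for all $i<m$. An *inhomogeneous cellular string* is a sequence $F_1,\dots,F_m$ of nonempty faces of $P$ such that for every $i<m$ either $F_i\in s(F_{i+1})$ or $F_{i+1}\in t(F_i)$. Such a string is a *cellular loop* (for some $k\ge0$), resp. an *inhomogeneous cellular loop*, if $F_i=F_j$ for some $i\neq j$. A *based augmented chain complex* $C$ consists of free abelian groups $C_n$ ($n\ge 0$) with bases $B_n$, boundary maps $\partial\colon C_{n+1}\to C_n$ and an augmentation $\varepsilon\colon C_0\to\mathbb Z$ with $\partial\partial=0$, $\varepsilon\partial=0$ and $\varepsilon(b)=1$ for $b\in B_0$. Write $\partial c=\partial^+c-\partial^-c$ for the decomposition of $\partial c$ into its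 positive and negative parts with respect to the basis, and for $c\in C_n$ put $\langle c\rangle_n^\pm=c$ and $\langle c\rangle_k^{\pm}=\partial^{\pm}\langle c\rangle_{k+1}^\pm$ for $k<n$. The basis is *unital* if $\varepsilon\langle b\rangle_0^{\pm}=1$ for every basis element $b$ and both signs. It is *loop-free* if for every $k\ge0$ the transitive closure of the relation $<_k$ is antisymmetric, where, for basis elements $b,b'$ of degree $>k$, $b<_kb'$ means that some basis element has nonzero coefficient in both $\langle b\rangle_k^+$ and $\langle b'\rangle_k^-$. It is *strongly loop-free* if the transitive closure of the following relation on all basis elements is antisymmetric: $b$ precedes $b'$ if $b$ has nonzero coefficient in $\partial^-b'$ or $b'$ has nonzero coefficient in $\partial^+b$. A *Steiner diagram* is a based augmented chain complex whose basis is unital and loop-free; a *strong Steiner diagram* is a Steiner diagram whose basis is strongly loop-free. **Theorem.** Let $P$ be a framed polytope and let $C(P)$ be generated in degree $n$ by the $n$-faces of $P$ ($n\ge 0$), with $\partial F=\sum_{E\in t(F)}E-\sum_{E\in s(F)}E$ and $\varepsilon(v)=1$ for every vertex $v$. Then $C(P)$ is a based augmented chain complex and its basis is unital. Moreover: 1.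 $C(P)$ is a Steiner diagram if and only if $P$ has no cellular loops (for any $k\ge 0$); 2. $C(P)$ is a strong Steiner diagram if and only if $P$ has no inhomogeneous cellular loops. -/

import Mathlib

/-! ## Polytopes, faces, orientations -/

/-- The convex hull of a finite set of points. -/
def IsPolytope {d : ℕ} (P : Set (Fin d → ℝ)) : Prop :=
  ∃ S : Set (Fin d → ℝ), S.Finite ∧ P = convexHull ℝ S

/-- The linear span `Lin P`, spanned by the differences of points of `P`. -/
abbrev linSpan {d : ℕ} (P : Set (Fin d → ℝ)) : Submodule ℝ (Fin d → ℝ) :=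
  vectorSpan ℝ P

/-- The dimension of a (nonempty) polytope: the dimension of its affine span. -/
noncomputable def polyDim {d : ℕ} (P : Set (Fin d → ℝ)) : ℕ :=
  Module.finrank ℝ (linSpan P)

theorem polyDim_le {d : ℕ} (P : Set (Fin d → ℝ)) : polyDim P ≤ d :=
  (Submodule.finrank_le (linSpan P)).trans_eq (by simp)

/-- `F` is a nonempty face of `P`: the locus where some linear functional is maximal on `P`. -/
def IsFace {d : ℕ} (P F : Set (Fin d → ℝ)) : Prop :=
  F.Nonempty ∧ IsExposed ℝ P F

/-- A (nonempty) face of codimension one; the set of all of these is the boundary of `P`. -/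
def IsFacet {d : ℕ} (P F : Set (Fin d → ℝ)) : Prop :=
  IsFace P F ∧ polyDim F + 1 = polyDim P

/-- The normal cone of `F` in `P`: functionals whose maximal locus on `P` is exactly `F`. -/
def normalCone {d : ℕ} (P F : Set (Fin d → ℝ)) : Set (StrongDual ℝ (Fin d → ℝ)) :=
  {ψ | ψ.toExposed P = F}

/-- Equivalence of generators of a top exterior power: equality up to a positive scalar. -/
def OrientEquiv {d : ℕ} (β β' : ExteriorAlgebra ℝ (Fin d → ℝ)) : Prop :=
  ∃ c : ℝ, 0 < c ∧ β = c • β'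

/-- The facet `E` is in the source of `P`, for the orientations `β F` of the faces: the
orientation of `E` wedged on the right with an inner-pointing vector of `Lin P` is that of `P`. -/
def IsSource {d : ℕ} (β : Set (Fin d → ℝ) → ExteriorAlgebra ℝ (Fin d → ℝ))
    (P E : Set (Fin d → ℝ)) : Prop :=
  IsFacet P E ∧ ∃ v ∈ linSpan P, ∃ ψ ∈ normalCone P E,
    ψ v < 0 ∧ OrientEquiv (β P) (β E * ExteriorAlgebra.ι ℝ v)

/-- The facet `E` is in the target of `P`: same as `IsSource`, with an outer-pointing vector. -/
def IsTarget {d : ℕ} (β : Set (Fin d → ℝ) → ExteriorAlgebra ℝ (Fin d → ℝ))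
    (P E : Set (Fin d → ℝ)) : Prop :=
  IsFacet P E ∧ ∃ v ∈ linSpan P, ∃ ψ ∈ normalCone P E,
    0 < ψ v ∧ OrientEquiv (β P) (β E * ExteriorAlgebra.ι ℝ v)

/-! ## Frames -/

/-- A frame: an ordered basis `(v₁, …, v_d)` of `ℝ^d`; the vector `v_{i+1}` is `B i`. -/
abbrev Frame (d : ℕ) := Module.Basis (Fin d) ℝ (Fin d → ℝ)

namespace Frame

/-- `V_k`, the span of the first `k` vectors of the frame. -/
def flag {d : ℕ} (B : Frame d) (k : ℕ) : Submodule ℝ (Fin d → ℝ) :=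
  Submodule.span ℝ (B '' {i | i.val < k})

/-- The projection `π_k` (onto `V_k`): it fixes the first `k` vectors of the frame and kills
the others. -/
noncomputable def proj {d : ℕ} (B : Frame d) (k : ℕ) : (Fin d → ℝ) →ₗ[ℝ] (Fin d → ℝ) :=
  B.constr ℝ fun i => if i.val < k then B i else 0

/-- `P`-admissibility: for every `k`-face `F` of `P`, the linear map `π_k` restricts to an
isomorphism from `Lin F` to `V_k`. -/
def IsAdmissible {d : ℕ} (B : Frame d) (P : Set (Fin d → ℝ)) : Prop :=
  ∀ F, IsFace P F →
    Set.BijOn (B.proj (polyDim F)) (linSpan F : Set (Fin d → ℝ)) (B.flag (polyDim F))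

/-- `σ_k^F`, the inverse of `π_k : Lin F → V_k`, where `k = dim F`. -/
noncomputable def sect {d : ℕ} (B : Frame d) (F : Set (Fin d → ℝ)) :
    (Fin d → ℝ) → (Fin d → ℝ) :=
  Function.invFunOn (B.proj (polyDim F)) (linSpan F)

/-- The induced orientation `σ(v₁) ∧ ⋯ ∧ σ(v_k)` of a `k`-dimensional face `F`, which is `1` for
`k = 0`. The `k`-th exterior power of `Lin F` is viewed inside the exterior algebra of `ℝ^d`. -/
noncomputable def orient {d : ℕ} (B : Frame d) (F : Set (Fin d → ℝ)) :
    ExteriorAlgebra ℝ (Fin d → ℝ) :=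
  ExteriorAlgebra.ιMulti ℝ (polyDim F) fun i => B.sect F (B (Fin.castLE (polyDim_le F) i))

/-- `E` is in the `k`-boundary of `F`: it is a `k`-face of `F` and `π_{k+1}` maps it onto a facet
of `π_{k+1}(F)`. -/
def IsKBoundary {d : ℕ} (B : Frame d) (k : ℕ) (F E : Set (Fin d → ℝ)) : Prop :=
  IsFace F E ∧ polyDim E = k ∧ IsFacet (B.proj (k + 1) '' F) (B.proj (k + 1) '' E)

/-- `E ∈ s_k(F)`. The projected polytope `π_{k+1}(F)` lies in `V_{k+1}` and is framed by
`(v₁, …, v_{k+1})`; the projections `π_j`, `j ≤ k + 1`, of that frame are the restrictions to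
`V_{k+1}` of those of `B`, so that `B.orient` is its induced orientation too. -/
def IsKSource {d : ℕ} (B : Frame d) (k : ℕ) (F E : Set (Fin d → ℝ)) : Prop :=
  B.IsKBoundary k F E ∧ IsSource B.orient (B.proj (k + 1) '' F) (B.proj (k + 1) '' E)

/-- `E ∈ t_k(F)`. -/
def IsKTarget {d : ℕ} (B : Frame d) (k : ℕ) (F E : Set (Fin d → ℝ)) : Prop :=
  B.IsKBoundary k F E ∧ IsTarget B.orient (B.proj (k + 1) '' F) (B.proj (k + 1) '' E)

end Frame

/-- A polytope in `ℝ^d` with an admissible frame. -/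
structure FramedPolytope (d : ℕ) where
  carrier : Set (Fin d → ℝ)
  isPolytope : IsPolytope carrier
  frame : Frame d
  admissible : frame.IsAdmissible carrier

theorem IsPolytope.finite_faces {d : ℕ} {P : Set (Fin d → ℝ)} (hP : IsPolytope P) :
    {F | IsFace P F}.Finite := by
  obtain ⟨S, hS, rfl⟩ := hP
  have hc : IsCompact (convexHull ℝ S) := hS.isCompact_convexHull ℝ
  refine (hS.finite_subsets.image fun T => closure (convexHull ℝ T)).subset ?_
  rintro F ⟨-, hF⟩
  refine ⟨F.extremePoints ℝ, ?_, ?_⟩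
  · exact hF.isExtreme.extremePoints_subset_extremePoints.trans extremePoints_convexHull_subset
  · exact closure_convexHull_extremePoints (hF.isCompact hc) (hF.convex (convex_convexHull ℝ S))

namespace FramedPolytope

/-- The nonempty faces of `P`. -/
def Face {d : ℕ} (P : FramedPolytope d) : Type :=
  {F : Set (Fin d → ℝ) // IsFace P.carrier F}

/-- The `k`-faces of `P`. -/
def KFace {d : ℕ} (P : FramedPolytope d) (k : ℕ) : Type :=
  {F : Set (Fin d → ℝ) // IsFace P.carrier F ∧ polyDim F = k}

instance {d : ℕ} (P : FramedPolytope d) (k : ℕ) : Finite (P.KFace k) :=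
  (P.isPolytope.finite_faces.subset fun _ h => h.1 :
    {F | IsFace P.carrier F ∧ polyDim F = k}.Finite).to_subtype

/-! ## Cellular strings and loops -/

/-- A cellular `k`-string `F₁, …, F_m`: faces of dimension greater than `k` such that
`t_k(F_i) ∩ s_k(F_{i+1})` is nonempty for all `i < m`. -/
def IsCellularString {d : ℕ} (P : FramedPolytope d) (k : ℕ) (l : List P.Face) : Prop :=
  (∀ F ∈ l, k < polyDim F.1) ∧
    l.IsChain fun F G => ∃ E, P.frame.IsKTarget k F.1 E ∧ P.frame.IsKSource k G.1 E

/-- An inhomogeneous cellular string `F₁, …, F_m`: for all `i < m`, either `F_i ∈ s(F_{i+1})` or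
`F_{i+1} ∈ t(F_i)`. -/
def IsInhomogeneousString {d : ℕ} (P : FramedPolytope d) (l : List P.Face) : Prop :=
  l.IsChain fun F G => IsSource P.frame.orient G.1 F.1 ∨ IsTarget P.frame.orient F.1 G.1

/-- A cellular `k`-loop: a cellular `k`-string with `F_i = F_j` for some `i ≠ j`. -/
def IsCellularLoop {d : ℕ} (P : FramedPolytope d) (k : ℕ) (l : List P.Face) : Prop :=
  P.IsCellularString k l ∧ ¬ l.Nodup

/-- An inhomogeneous cellular loop: such a string with `F_i = F_j` for some `i ≠ j`. -/
def IsInhomogeneousLoop {d : ℕ} (P : FramedPolytope d) (l : List P.Face) : Prop :=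
  P.IsInhomogeneousString l ∧ ¬ l.Nodup

end FramedPolytope

/-! ## Based augmented chain complexes and Steiner diagrams -/

/-- The data of a based augmented chain complex: a graded basis, with boundary and augmentation
maps on the free abelian groups it generates. The axioms are in `IsComplex`. -/
structure BasedAugmentedData where
  basis : ℕ → Type
  bd : ∀ n, (basis (n + 1) →₀ ℤ) →ₗ[ℤ] (basis n →₀ ℤ)
  aug : (basis 0 →₀ ℤ) →ₗ[ℤ] ℤ

/-- A sign `-` or `+`. -/
inductive PM where
  | neg
  | pos

namespace BasedAugmentedData

/-- The axioms of a based augmented chain complex: `∂ ∘ ∂ = 0`, `ε ∘ ∂ = 0`, and `ε(b) = 1` for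
each basis element `b` of degree zero. -/
def IsComplex (C : BasedAugmentedData) : Prop :=
  (∀ n, C.bd n ∘ₗ C.bd (n + 1) = 0) ∧ C.aug ∘ₗ C.bd 0 = 0 ∧
    ∀ b, C.aug (Finsupp.single b 1) = 1

/-- `∂⁺ c` and `∂⁻ c`: the positive and the negative part of `∂ c` in the given basis, so that
`∂ c = ∂⁺ c - ∂⁻ c`. -/
noncomputable def bdPart (C : BasedAugmentedData) (s : PM) (n : ℕ) (c : C.basis (n + 1) →₀ ℤ) :
    C.basis n →₀ ℤ :=
  match s with
  | .pos => (C.bd n c)⁺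
  | .neg => (C.bd n c)⁻

/-- `⟨c⟩_k^±` for `c` of degree `n ≥ k`: `⟨c⟩_n^± = c` and `⟨c⟩_k^± = ∂^± ⟨c⟩_{k+1}^±`. -/
noncomputable def atom (C : BasedAugmentedData) (s : PM) {n : ℕ} (c : C.basis n →₀ ℤ)
    {k : ℕ} (h : k ≤ n) : C.basis k →₀ ℤ :=
  Nat.decreasingInduction (motive := fun m _ => C.basis m →₀ ℤ)
    (fun m _ x => C.bdPart s m x) c h

/-- The basis is unital: `ε ⟨b⟩_0^± = 1` for every basis element `b`. -/
def IsUnital (C : BasedAugmentedData) : Prop :=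
  ∀ (n : ℕ) (b : C.basis n) (s : PM),
    C.aug (C.atom s (Finsupp.single b 1) (Nat.zero_le n)) = 1

/-- The relation `b <_k b'` on basis elements of degree greater than `k`: some basis element has
nonzero coefficient in both `⟨b⟩_k^+` and `⟨b'⟩_k^-`. -/
def precK (C : BasedAugmentedData) (k : ℕ) (b b' : {b : Σ n, C.basis n // k < b.1}) : Prop :=
  ∃ x : C.basis k,
    C.atom .pos (Finsupp.single b.1.2 1) b.2.le x ≠ 0 ∧
      C.atom .neg (Finsupp.single b'.1.2 1) b'.2.le x ≠ 0

/-- The relation on all basis elements: `b` precedes `b'` if `b` has nonzero coefficient in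
`∂⁻ b'`, or `b'` has nonzero coefficient in `∂⁺ b`. -/
inductive prec (C : BasedAugmentedData) : (Σ n, C.basis n) → (Σ n, C.basis n) → Prop
  | neg {n : ℕ} (b : C.basis n) (b' : C.basis (n + 1)) :
      C.bdPart .neg n (Finsupp.single b' 1) b ≠ 0 → prec C ⟨n, b⟩ ⟨n + 1, b'⟩
  | pos {n : ℕ} (b : C.basis (n + 1)) (b' : C.basis n) :
      C.bdPart .pos n (Finsupp.single b 1) b' ≠ 0 → prec C ⟨n + 1, b⟩ ⟨n, b'⟩

/-- The basis is loop-free: for each `k` the transitive closure of `<_k` is antisymmetric. -/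
def IsLoopFree (C : BasedAugmentedData) : Prop :=
  ∀ k b b', Relation.TransGen (C.precK k) b b' → Relation.TransGen (C.precK k) b' b → b = b'

/-- The basis is strongly loop-free: the transitive closure of `prec` is antisymmetric. -/
def IsStronglyLoopFree (C : BasedAugmentedData) : Prop :=
  ∀ b b', Relation.TransGen C.prec b b' → Relation.TransGen C.prec b' b → b = b'

/-- A Steiner diagram: a based augmented chain complex with unital and loop-free basis. -/
def IsSteinerDiagram (C : BasedAugmentedData) : Prop :=
  C.IsComplex ∧ C.IsUnital ∧ C.IsLoopFree

/-- A strong Steiner diagram: a Steiner diagram whose basis is strongly loop-free. -/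
def IsStrongSteinerDiagram (C : BasedAugmentedData) : Prop :=
  C.IsSteinerDiagram ∧ C.IsStronglyLoopFree

end BasedAugmentedData

open scoped Classical in
/-- The chain complex of a framed polytope: it is generated by the nonempty faces, graded by
dimension, with `∂ F = ∑ t(F) - ∑ s(F)` and `ε(v) = 1` for every vertex `v`. -/
noncomputable def FramedPolytope.chains {d : ℕ} (P : FramedPolytope d) : BasedAugmentedData where
  basis := P.KFace
  bd n :=
    haveI : Fintype (P.KFace n) := Fintype.ofFinite _
    Finsupp.linearCombination ℤ fun F : P.KFace (n + 1) =>
      ((∑ E : P.KFace n with IsTarget P.frame.orient F.1 E.1, Finsupp.single E (1 : ℤ)) -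
        ∑ E : P.KFace n with IsSource P.frame.orient F.1 E.1, Finsupp.single E (1 : ℤ) :
          P.KFace n →₀ ℤ)
  aug := Finsupp.linearCombination ℤ fun _ => (1 : ℤ)

/-! ## Exposed faces of polytopes -/

section Faces

variable {d : ℕ} {f : StrongDual ℝ (Fin d → ℝ)} {P F E G : Set (Fin d → ℝ)}

/-! Everything reduces to one notion. For a `k`-face `E` of `F` with `k < dim F`, `height E` is the
functional that factors through `π_{k+1}`, vanishes on `Lin E` and is one at `v_{k+1}`. In
codimension one, `β_E ∧ v = height_E(v) β_F` (`IsRegular.orient_mul_ι`), so a facet lies in the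
target or source exactly when it is the locus of maximal or minimal height with respect to itself.
After projection the same criterion describes `t_k(F)` and `s_k(F)` in every codimension
(`IsAdmissible.isKSided_iff`); this is `IsExtremal`.

The central claim is that `⟨F⟩_k^±` is the sum of `t_k(F)`, resp. `s_k(F)` (`atom_single_apply`). By
descending induction it suffices that the boundary of the sum of `t_{k+1}(F)`, or of `s_{k+1}(F)`,
is the sum of `t_k(F)` minus that of `s_k(F)`. Fix a `k`-face `G`. Collapsing `Lin G` turns
`π_{k+2}(F)` into a polygon with `G` as a point. The faces `E` that contribute at `G` are the edges
of the upper (or lower) boundary path that end at `G`. There is at most one on each side, and a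
vertex of the path has one on a given side unless it is the end of the path there. The coefficient
is therefore [not leftmost] − [not rightmost] = [rightmost] − [leftmost]. Both paths share their
ends, which also gives `∂∂ = 0`. For vertices the height is the first coordinate, which has one
maximal and one minimal vertex; hence unitality and `ε∂ = 0`.

The precedence relations of the basis are now the string relations on faces. They are irreflexive,
so antisymmetry of the transitive closure means absence of cycles, that is, of loops. Finally,
intermediate extremal faces (`IsExtremal.exists_between`) refine every cellular string to an
inhomogeneous one, so excluding inhomogeneous loops excludes cellular ones. -/

theorem toExposed_eq_iff {p : Fin d → ℝ} (hp : p ∈ E) :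
    f.toExposed F = E ↔ E ⊆ F ∧ (∀ x ∈ F, f x ≤ f p) ∧ ∀ x ∈ F, f x = f p ↔ x ∈ E := by
  constructor
  · rintro rfl
    exact ⟨fun x hx => hx.1, fun x hx => hp.2 x hx, fun x hx =>
      ⟨fun h => ⟨hx, fun y hy => h ▸ hp.2 y hy⟩,
        fun h => le_antisymm (hp.2 x hx) (h.2 p hp.1)⟩⟩
  · rintro ⟨h1, h2, h3⟩
    ext x
    constructor
    · rintro ⟨hx, hm⟩
      exact (h3 x hx).1 (le_antisymm (h2 x hx) (hm p (h1 hp)))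
    · intro hx
      exact ⟨h1 hx, fun y hy => ((h3 x (h1 hx)).2 hx).symm ▸ h2 y hy⟩

theorem isFace_iff : IsFace P F ↔ F.Nonempty ∧ ∃ l : StrongDual ℝ (Fin d → ℝ), l.toExposed P = F :=
  ⟨fun ⟨h, h'⟩ => ⟨h, (h' h).imp fun _ e => e.symm⟩,
    fun ⟨h, l, e⟩ => ⟨h, fun _ => ⟨l, e.symm⟩⟩⟩

theorem IsFace.subset (h : IsFace P F) : F ⊆ P := by
  obtain ⟨-, l, rfl⟩ := isFace_iff.1 h
  exact fun x hx => hx.1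

theorem IsPolytope.convex (h : IsPolytope P) : Convex ℝ P := by
  obtain ⟨S, -, rfl⟩ := h
  exact convex_convexHull ℝ S

/-- Since this set is convex, a whole polytope lies in it as soon as its generators do. This is how
maximal loci are computed from finitely many points. -/
theorem convex_lt_union {c : ℝ} (hG : Convex ℝ G) (h : ∀ x ∈ G, f x = c) :
    Convex ℝ ({x | f x < c} ∪ G) := by
  intro x hx y hy a b ha hb hab
  rcases ha.eq_or_lt with rfl | ha
  · obtain rfl : b = 1 := by linarith
    simpa using hy
  rcases hb.eq_or_lt with rfl | hb
  · obtain rfl : a = 1 := by linarith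
    simpa using hx
  have key : f (a • x + b • y) = a * f x + b * f y := by simp
  have hc : c = a * c + b * c := by rw [← add_mul, hab, one_mul]
  rcases hx with hx | hx <;> rcases hy with hy | hy
  · left
    have h1 := mul_lt_mul_of_pos_left (show f x < c from hx) ha
    have h2 := mul_lt_mul_of_pos_left (show f y < c from hy) hb
    change f _ < c
    linarith
  · left
    have h1 := mul_lt_mul_of_pos_left (show f x < c from hx) ha
    change f _ < c
    rw [key, h y hy]
    linarith
  · left
    have h2 := mul_lt_mul_of_pos_left (show f y < c from hy) hb
    change f _ < c
    rw [key, h x hx]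
    linarith
  · exact Or.inr (hG hx hy ha.le hb.le hab)

theorem IsFace.isPolytope (hP : IsPolytope P) (h : IsFace P F) : IsPolytope F := by
  obtain ⟨⟨p, hp⟩, l, hl⟩ := isFace_iff.1 h
  have hF : Convex ℝ F := h.2.convex hP.convex
  obtain ⟨h1, h2, h3⟩ := (toExposed_eq_iff hp).1 hl
  obtain ⟨S, hS, rfl⟩ := hP
  refine ⟨S ∩ F, hS.subset Set.inter_subset_left, Set.Subset.antisymm ?_ ?_⟩
  · have hsub : convexHull ℝ (S ∩ F) ⊆ F := convexHull_min Set.inter_subset_right hF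
    have hc := convex_lt_union (f := l) (c := l p) (convex_convexHull ℝ (S ∩ F))
      fun x hx => (h3 x (h1 (hsub hx))).2 (hsub hx)
    have hS' : convexHull ℝ S ⊆ {x | l x < l p} ∪ convexHull ℝ (S ∩ F) := by
      refine convexHull_min (fun x hx => ?_) hc
      have hx' := subset_convexHull ℝ S hx
      rcases (h2 x hx').lt_or_eq with hlt | heq
      · exact Or.inl hlt
      · exact Or.inr (subset_convexHull ℝ _ ⟨hx, (h3 x hx').1 heq⟩)
    intro x hx
    rcases hS' (h1 hx) with hlt | hmem
    · exact absurd ((h3 x (h1 hx)).2 hx) (ne_of_lt hlt)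
    · exact hmem
  · exact convexHull_min Set.inter_subset_right hF

/-- A convex subset on which a functional is constant is the maximal locus of this functional as
soon as the functional is smaller on the other elements of a generating set. -/
theorem toExposed_convexHull {S : Set (Fin d → ℝ)} {p : Fin d → ℝ} (hG : Convex ℝ G) (hp : p ∈ G)
    (hsub : G ⊆ convexHull ℝ S) (hf : ∀ x ∈ G, f x = f p) (hS : ∀ x ∈ S, x ∉ G → f x < f p) :
    f.toExposed (convexHull ℝ S) = G := by
  have h : convexHull ℝ S ⊆ {x | f x < f p} ∪ G :=
    convexHull_min (fun x hx => (em (x ∈ G)).elim Or.inr fun h => Or.inl (hS x hx h))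
      (convex_lt_union hG hf)
  refine (toExposed_eq_iff hp).2 ⟨hsub, fun x hx => ?_, fun x hx => ⟨fun e => ?_, hf x⟩⟩
  · rcases h hx with h | h
    exacts [le_of_lt h, (hf x h).le]
  · rcases h hx with h | h
    exacts [absurd e (ne_of_lt h), h]

theorem toExposed_smul {c : ℝ} (hc : 0 < c) : (c • f).toExposed F = f.toExposed F := by
  ext x
  simp [ContinuousLinearMap.toExposed, hc]

/-- Lexicographic maximization is maximization of a single functional. -/
theorem IsPolytope.exists_toExposed_smul_add (hP : IsPolytope P) {l m : StrongDual ℝ (Fin d → ℝ)}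
    (hl : l.toExposed P = F) (hm : m.toExposed F = E) (hE : E.Nonempty) (hEc : Convex ℝ E) :
    ∃ N : ℝ, 0 < N ∧ (N • l + m).toExposed P = E := by
  obtain ⟨p, hp⟩ := hE
  obtain ⟨h1, h2, h3⟩ := (toExposed_eq_iff hp).1 hm
  obtain ⟨g1, g2, g3⟩ := (toExposed_eq_iff (h1 hp)).1 hl
  obtain ⟨S, hS, rfl⟩ := hP
  -- Only finitely many generators matter, so one large `N` makes the first functional dominate at
  -- all those where it is not maximal.
  have hev : ∀ᶠ N : ℝ in Filter.atTop, ∀ x ∈ S, l x < l p → (N • l + m) x < (N • l + m) p := by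
    rw [Filter.eventually_all_finite hS]
    intro x _
    by_cases hx : l x < l p
    · filter_upwards [Filter.eventually_gt_atTop ((m x - m p) / (l p - l x))] with N hN _
      rw [div_lt_iff₀ (by linarith)] at hN
      simp only [add_apply, smul_apply, smul_eq_mul]
      linarith
    · exact Filter.Eventually.of_forall fun _ h => absurd h hx
  obtain ⟨N, hN, hN0⟩ := (hev.and (Filter.eventually_gt_atTop 0)).exists
  refine ⟨N, hN0, toExposed_convexHull hEc hp (h1.trans g1) ?_ ?_⟩
  · intro x hx
    simp [(g3 x (g1 (h1 hx))).2 (h1 hx), (h3 x (h1 hx)).2 hx]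
  · intro x hx hxE
    have hx' := subset_convexHull ℝ S hx
    rcases (g2 x hx').lt_or_eq with hlt | heq
    · exact hN x hx hlt
    · have hxF := (g3 x hx').1 heq
      have := lt_of_le_of_ne (h2 x hxF) fun e => hxE ((h3 x hxF).1 e)
      simp only [add_apply, smul_apply, heq]
      linarith

theorem IsFace.convex (hP : IsPolytope P) (hF : IsFace P F) : Convex ℝ F :=
  hF.2.convex hP.convex

theorem IsFace.trans (hP : IsPolytope P) (hF : IsFace P F) (hE : IsFace F E) : IsFace P E := by
  obtain ⟨hne, m, hm⟩ := isFace_iff.1 hE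
  obtain ⟨-, l, hl⟩ := isFace_iff.1 hF
  obtain ⟨N, -, hN⟩ := hP.exists_toExposed_smul_add hl hm hne (hE.convex (hF.isPolytope hP))
  exact isFace_iff.2 ⟨hne, _, hN⟩

theorem isFace_self (hF : F.Nonempty) : IsFace F F :=
  isFace_iff.2 ⟨hF, 0, by ext; simp [ContinuousLinearMap.toExposed]⟩

/-! ### Functionals on the linear span of a face -/

theorem sub_mem_linSpan {x y : Fin d → ℝ} (hx : x ∈ E) (hy : y ∈ E) : x - y ∈ linSpan E :=
  vsub_mem_vectorSpan ℝ hx hy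

theorem eq_zero_of_mem_linSpan (h : ∀ x ∈ E, ∀ y ∈ E, f x = f y) {w : Fin d → ℝ}
    (hw : w ∈ linSpan E) : f w = 0 := by
  have : linSpan E ≤ LinearMap.ker (f : (Fin d → ℝ) →ₗ[ℝ] ℝ) := by
    refine Submodule.span_le.2 ?_
    rintro _ ⟨x, hx, y, hy, rfl⟩
    simp [h x hx y hy]
  exact this hw

theorem apply_eq_of_linSpan (h : ∀ w ∈ linSpan E, f w = 0) {x y : Fin d → ℝ} (hx : x ∈ E)
    (hy : y ∈ E) : f x = f y := by
  have := h _ (sub_mem_linSpan hx hy)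
  rwa [map_sub, sub_eq_zero] at this

theorem toExposed_eq_zero (h : f.toExposed F = E) {w : Fin d → ℝ} (hw : w ∈ linSpan E) :
    f w = 0 := by
  refine eq_zero_of_mem_linSpan (fun x hx y hy => ?_) hw
  obtain ⟨h1, -, h3⟩ := (toExposed_eq_iff hx).1 h
  exact ((h3 y (h1 hy)).2 hy).symm

theorem IsFace.linSpan_le (h : IsFace F E) : linSpan E ≤ linSpan F := vectorSpan_mono ℝ h.subset

/-- Equal dimensions force equal linear spans, so the functional exposing `E` is constant on `G`. -/
theorem IsFace.eq_of_subset (hE : IsFace F E) (hG : E ⊆ G) (hGF : G ⊆ F)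
    (hdim : polyDim G ≤ polyDim E) : G = E := by
  have hlin : linSpan E = linSpan G :=
    Submodule.eq_of_le_of_finrank_le (vectorSpan_mono ℝ hG) hdim
  obtain ⟨⟨p, hp⟩, l, hl⟩ := isFace_iff.1 hE
  refine Set.Subset.antisymm (fun x hx => ?_) hG
  refine (((toExposed_eq_iff hp).1 hl).2.2 x (hGF hx)).1 ?_
  have := toExposed_eq_zero hl (hlin ▸ sub_mem_linSpan hx (hG hp) : x - p ∈ linSpan E)
  rwa [map_sub, sub_eq_zero] at this

theorem IsFace.of_toExposed (h : f.toExposed F = E) (hE : E.Nonempty) : IsFace F E :=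
  isFace_iff.2 ⟨hE, f, h⟩

end Faces

/-! ## Projections and sections of a frame -/

namespace Frame

section Linear

variable {d : ℕ} (B : Frame d)

theorem proj_basis (k : ℕ) (i : Fin d) : B.proj k (B i) = if i.val < k then B i else 0 := by
  rw [proj, B.constr_basis]

theorem repr_proj (k : ℕ) (x : Fin d → ℝ) (i : Fin d) :
    B.repr (B.proj k x) i = if i.val < k then B.repr x i else 0 := by
  have : B.coord i ∘ₗ B.proj k = if i.val < k then B.coord i else 0 := by
    refine B.ext fun j => ?_
    by_cases hij : j = i
    · subst hij
      by_cases h : j.val < k <;> simp [proj_basis, h]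
    · by_cases h : j.val < k <;> by_cases h' : i.val < k <;> simp [proj_basis, h, h', hij]
  have := LinearMap.congr_fun this x
  split_ifs at this ⊢ <;> simpa using this

theorem mem_flag_iff {k : ℕ} {x : Fin d → ℝ} : x ∈ B.flag k ↔ B.proj k x = x := by
  rw [flag, B.mem_span_image]
  constructor
  · intro h
    refine B.ext_elem fun i => ?_
    rw [repr_proj]
    split_ifs with hi
    · rfl
    · by_contra hne
      exact hi (h (Finsupp.mem_support_iff.2 (Ne.symm hne)))
  · intro h i hi
    by_contra hik
    have := B.repr_proj k x i
    rw [h, if_neg (show ¬ i.val < k from hik)] at this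
    exact Finsupp.mem_support_iff.1 hi this

theorem proj_proj (j k : ℕ) (x : Fin d → ℝ) : B.proj j (B.proj k x) = B.proj (min j k) x := by
  refine B.ext_elem fun i => ?_
  simp only [repr_proj, lt_min_iff]
  split_ifs <;> simp_all

theorem proj_proj_of_le {j k : ℕ} (h : j ≤ k) (x : Fin d → ℝ) :
    B.proj j (B.proj k x) = B.proj j x := by
  rw [proj_proj, min_eq_left h]

theorem proj_mem_flag (k : ℕ) (x : Fin d → ℝ) : B.proj k x ∈ B.flag k := by
  rw [mem_flag_iff, proj_proj, min_self]

theorem flag_mono {j k : ℕ} (h : j ≤ k) : B.flag j ≤ B.flag k :=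
  Submodule.span_mono (Set.image_mono fun _ hi => lt_of_lt_of_le hi h)

theorem basis_mem_flag {k : ℕ} {i : Fin d} (h : i.val < k) : B i ∈ B.flag k :=
  Submodule.subset_span ⟨i, h, rfl⟩

theorem proj_basis_of_lt {k : ℕ} {i : Fin d} (h : i.val < k) : B.proj k (B i) = B i :=
  B.mem_flag_iff.1 (B.basis_mem_flag h)

theorem proj_basis_of_le {k : ℕ} {i : Fin d} (h : k ≤ i.val) : B.proj k (B i) = 0 := by
  rw [proj_basis, if_neg h.not_gt]

theorem finrank_flag {k : ℕ} (hk : k ≤ d) : Module.finrank ℝ (B.flag k) = k := by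
  have hli : LinearIndependent ℝ fun i : Fin k => B (Fin.castLE hk i) :=
    B.linearIndependent.comp _ (Fin.castLE_injective hk)
  have hr : Set.range (fun i : Fin k => B (Fin.castLE hk i)) = B '' {i | i.val < k} := by
    ext x
    constructor
    · rintro ⟨i, rfl⟩
      exact ⟨_, i.2, rfl⟩
    · rintro ⟨i, hi, rfl⟩
      exact ⟨⟨i, hi⟩, rfl⟩
  rw [flag, ← hr, finrank_span_eq_card hli, Fintype.card_fin]

/-- The coordinate functional of the `k`-th vector of a frame (counted from zero). -/
noncomputable def coordinate (k : ℕ) : StrongDual ℝ (Fin d → ℝ) :=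
  if h : k < d then LinearMap.toContinuousLinearMap (B.coord ⟨k, h⟩) else 0

theorem coordinate_apply {k : ℕ} (h : k < d) (x : Fin d → ℝ) :
    B.coordinate k x = B.repr x ⟨k, h⟩ := by
  simp [coordinate, h]

theorem coordinate_proj {j k : ℕ} (h : j < k) (x : Fin d → ℝ) :
    B.coordinate j (B.proj k x) = B.coordinate j x := by
  by_cases hj : j < d
  · simp [B.coordinate_apply hj, repr_proj, h]
  · simp [coordinate, hj]

theorem coordinate_basis_self {k : ℕ} (h : k < d) : B.coordinate k (B ⟨k, h⟩) = 1 := by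
  simp [B.coordinate_apply h]

theorem coordinate_basis_ne {j k : ℕ} (h : k < d) (hjk : k ≠ j) :
    B.coordinate j (B ⟨k, h⟩) = 0 := by
  by_cases hj : j < d
  · rw [B.coordinate_apply hj, B.repr_self, Finsupp.single_apply, if_neg (by simpa using hjk)]
  · simp [coordinate, hj]

theorem proj_succ {k : ℕ} (h : k < d) (x : Fin d → ℝ) :
    B.proj (k + 1) x = B.proj k x + B.coordinate k x • B ⟨k, h⟩ := by
  refine B.ext_elem fun i => ?_
  simp only [repr_proj, map_add, map_smul, Finsupp.add_apply, Finsupp.smul_apply, B.repr_self,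
    B.coordinate_apply h, Finsupp.single_apply, smul_eq_mul]
  rcases lt_trichotomy i.val k with hi | hi | hi
  · have : (⟨k, h⟩ : Fin d) ≠ i := by rintro rfl; simp at hi
    simp [hi, hi.trans (Nat.lt_succ_self k), this]
  · obtain rfl : i = ⟨k, h⟩ := Fin.ext hi
    simp
  · have : (⟨k, h⟩ : Fin d) ≠ i := by rintro rfl; simp at hi
    have h2 : ¬ i.val < k + 1 := by omega
    simp [hi.le.not_gt, h2, this]

/-- The map `π_k : Lin F → V_k`, `k = dim F`, is an isomorphism. -/
def IsRegular (F : Set (Fin d → ℝ)) : Prop :=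
  Set.BijOn (B.proj (polyDim F)) (linSpan F : Set (Fin d → ℝ)) (B.flag (polyDim F))

/-! ### Regular sets, their section maps and heights -/

variable {B} {F E G : Set (Fin d → ℝ)}

theorem IsRegular.ext (h : B.IsRegular F) {x y : Fin d → ℝ} (hx : x ∈ linSpan F)
    (hy : y ∈ linSpan F) (e : B.proj (polyDim F) x = B.proj (polyDim F) y) : x = y :=
  h.injOn hx hy e

theorem IsRegular.exists_preimage (h : B.IsRegular F) {k : ℕ} (hk : k ≤ polyDim F)
    {y : Fin d → ℝ} (hy : y ∈ B.flag k) : ∃ x ∈ linSpan F, B.proj k x = y := by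
  obtain ⟨x, hx, e⟩ := h.surjOn (B.flag_mono hk hy)
  refine ⟨x, hx, ?_⟩
  rw [← B.proj_proj_of_le hk, e, B.mem_flag_iff.1 hy]

theorem IsRegular.exists_sectionMap (h : B.IsRegular F) :
    ∃ σ : (Fin d → ℝ) →ₗ[ℝ] (Fin d → ℝ), (∀ x, σ x ∈ linSpan F) ∧
      ∀ x, B.proj (polyDim F) (σ x) = B.proj (polyDim F) x := by
  obtain ⟨g, hg⟩ := LinearMap.exists_leftInverse_of_injective
    ((B.proj (polyDim F)).domRestrict (linSpan F)) (by
      refine LinearMap.ker_eq_bot.2 fun x y e => ?_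
      exact Subtype.ext (h.ext x.2 y.2 e))
  refine ⟨(linSpan F).subtype ∘ₗ g ∘ₗ B.proj (polyDim F), fun x => (g _).2, fun x => ?_⟩
  obtain ⟨y, hy, e⟩ := h.surjOn (B.proj_mem_flag (polyDim F) x)
  have := LinearMap.congr_fun hg ⟨y, hy⟩
  simp only [LinearMap.coe_comp, Function.comp_apply, LinearMap.domRestrict_apply, e,
    LinearMap.id_apply] at this
  simp [this, e]

variable (B) in
/-- A linear extension to the whole space of the inverse of `π_k : Lin F → V_k`, `k = dim F`;
it is only meaningful if this map is an isomorphism. -/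
noncomputable def sectionMap (F : Set (Fin d → ℝ)) : (Fin d → ℝ) →ₗ[ℝ] (Fin d → ℝ) :=
  Classical.epsilon fun σ => (∀ x, σ x ∈ linSpan F) ∧
    ∀ x, B.proj (polyDim F) (σ x) = B.proj (polyDim F) x

theorem IsRegular.sectionMap_mem (h : B.IsRegular F) (x : Fin d → ℝ) :
    B.sectionMap F x ∈ linSpan F :=
  (Classical.epsilon_spec h.exists_sectionMap).1 x

theorem IsRegular.proj_sectionMap (h : B.IsRegular F) (x : Fin d → ℝ) :
    B.proj (polyDim F) (B.sectionMap F x) = B.proj (polyDim F) x :=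
  (Classical.epsilon_spec h.exists_sectionMap).2 x

theorem IsRegular.sectionMap_eq (h : B.IsRegular F) {x y : Fin d → ℝ} (hy : y ∈ linSpan F)
    (e : B.proj (polyDim F) x = B.proj (polyDim F) y) : B.sectionMap F x = y :=
  h.ext (h.sectionMap_mem x) hy ((h.proj_sectionMap x).trans e)

theorem IsRegular.sectionMap_basis_of_le (h : B.IsRegular F) {i : Fin d}
    (hi : polyDim F ≤ i.val) : B.sectionMap F (B i) = 0 :=
  h.sectionMap_eq (zero_mem _) (by rw [B.proj_basis_of_le hi, map_zero])

theorem IsRegular.sect_eq (h : B.IsRegular F) {x : Fin d → ℝ} (hx : x ∈ B.flag (polyDim F)) :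
    B.sect F x = B.sectionMap F x := by
  have hx' : ∃ a ∈ (linSpan F : Set (Fin d → ℝ)), B.proj (polyDim F) a = x := h.surjOn hx
  refine (h.sectionMap_eq (Function.invFunOn_mem hx') ?_).symm
  rw [B.mem_flag_iff.1 hx]
  exact (Function.invFunOn_eq hx').symm

variable (B) in
/-- The `j`-th coordinate of the vertical displacement from `Lin F`. -/
noncomputable def displacement (F : Set (Fin d → ℝ)) (j : ℕ) : StrongDual ℝ (Fin d → ℝ) :=
  B.coordinate j ∘L
    LinearMap.toContinuousLinearMap (LinearMap.id - B.sectionMap F)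

variable (B) in
/-- The functional on `V_{k+1}`, `k = dim F`, which vanishes on `Lin F` and takes the value one
at the last vector of the frame of `V_{k+1}`. -/
noncomputable def height (F : Set (Fin d → ℝ)) : StrongDual ℝ (Fin d → ℝ) :=
  B.displacement F (polyDim F)

variable (B) in
theorem displacement_apply (F : Set (Fin d → ℝ)) (j : ℕ) (x : Fin d → ℝ) :
    B.displacement F j x = B.coordinate j (x - B.sectionMap F x) := rfl

theorem IsRegular.displacement_eq_zero (h : B.IsRegular F) {j : ℕ} {x : Fin d → ℝ}
    (hx : x ∈ linSpan F) : B.displacement F j x = 0 := by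
  rw [displacement_apply, h.sectionMap_eq hx rfl, sub_self, map_zero]

theorem IsRegular.displacement_proj (h : B.IsRegular F) {j k : ℕ} (hk : polyDim F ≤ k)
    (hj : j < k) (x : Fin d → ℝ) : B.displacement F j (B.proj k x) = B.displacement F j x := by
  have : B.sectionMap F (B.proj k x) = B.sectionMap F x :=
    h.sectionMap_eq (h.sectionMap_mem x) (by
      rw [B.proj_proj_of_le hk, h.proj_sectionMap])
  rw [displacement_apply, displacement_apply, this, map_sub, map_sub, B.coordinate_proj hj]

theorem IsRegular.displacement_basis (h : B.IsRegular F) {j : ℕ} {i : Fin d}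
    (hi : polyDim F ≤ i.val) : B.displacement F j (B i) = B.coordinate j (B i) := by
  rw [displacement_apply, h.sectionMap_basis_of_le hi, sub_zero]

theorem IsRegular.height_eq_zero (h : B.IsRegular F) {x : Fin d → ℝ} (hx : x ∈ linSpan F) :
    B.height F x = 0 :=
  h.displacement_eq_zero hx

theorem IsRegular.height_proj (h : B.IsRegular F) {k : ℕ} (hk : polyDim F < k) (x : Fin d → ℝ) :
    B.height F (B.proj k x) = B.height F x :=
  h.displacement_proj hk.le hk x

theorem IsRegular.height_basis (h : B.IsRegular F) (hd : polyDim F < d) :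
    B.height F (B ⟨polyDim F, hd⟩) = 1 := by
  rw [height, h.displacement_basis le_rfl, B.coordinate_basis_self]

theorem IsRegular.proj_sub_sectionMap (h : B.IsRegular F) (hd : polyDim F < d) (x : Fin d → ℝ) :
    B.proj (polyDim F + 1) (x - B.sectionMap F x) = B.height F x • B ⟨polyDim F, hd⟩ := by
  rw [B.proj_succ hd, map_sub, h.proj_sectionMap, sub_self, zero_add]
  rfl

theorem IsRegular.height_unique (h : B.IsRegular F) (hd : polyDim F < d)
    {f : StrongDual ℝ (Fin d → ℝ)} (hf : ∀ x, f (B.proj (polyDim F + 1) x) = f x)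
    (h0 : ∀ x ∈ linSpan F, f x = 0) (h1 : f (B ⟨polyDim F, hd⟩) = 1) : f = B.height F := by
  ext1 x
  have h2 : f x = f (x - B.sectionMap F x) := by
    rw [map_sub, h0 _ (h.sectionMap_mem x), sub_zero]
  rw [h2, ← hf, h.proj_sub_sectionMap hd, map_smul, h1, smul_eq_mul, mul_one]

/-- The functionals on `V_{k+2}`, `k = dim F`, which vanish on `Lin F` form a plane. -/
theorem IsRegular.eq_displacement (h : B.IsRegular F) (hd : polyDim F + 1 < d)
    {f : StrongDual ℝ (Fin d → ℝ)} (hf : ∀ x, f (B.proj (polyDim F + 2) x) = f x)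
    (h0 : ∀ x ∈ linSpan F, f x = 0) (x : Fin d → ℝ) :
    f x = f (B ⟨polyDim F, by omega⟩) * B.height F x +
      f (B ⟨polyDim F + 1, hd⟩) * B.displacement F (polyDim F + 1) x := by
  have h2 : f x = f (x - B.sectionMap F x) := by
    rw [map_sub, h0 _ (h.sectionMap_mem x), sub_zero]
  rw [h2, ← hf, B.proj_succ hd, h.proj_sub_sectionMap (by omega), map_add, map_smul, map_smul,
    smul_eq_mul, smul_eq_mul, mul_comm, mul_comm (f (B ⟨polyDim F + 1, hd⟩))]
  rfl

/-- A functional on `V_{k+1}` which is nontrivial on the last vector is not constant on sets of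
dimension larger than `k`. -/
theorem IsRegular.polyDim_le_of_eq_zero (h : B.IsRegular F) {k : ℕ} (hd : k < d)
    {f : StrongDual ℝ (Fin d → ℝ)} (hf : ∀ x, f (B.proj (k + 1) x) = f x)
    (h0 : ∀ x ∈ linSpan F, f x = 0) (h1 : f (B ⟨k, hd⟩) ≠ 0) : polyDim F ≤ k := by
  by_contra hlt
  -- In larger dimension the vector `B ⟨k, hd⟩` would lift to `Lin F`, where `f` vanishes.
  obtain ⟨x, hx, e⟩ := h.exists_preimage (show k + 1 ≤ polyDim F by omega)
    (B.basis_mem_flag (i := ⟨k, hd⟩) (Nat.lt_succ_self k))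
  rw [← e, hf, h0 x hx] at h1
  exact h1 rfl

/-! ### Projections of regular sets -/

theorem linSpan_proj_image (k : ℕ) (F : Set (Fin d → ℝ)) :
    linSpan (B.proj k '' F) = (linSpan F).map (B.proj k) :=
  ((B.proj k).toAffineMap.map_vectorSpan (s := F)).symm

theorem IsRegular.linSpan_proj (h : B.IsRegular F) {k : ℕ} (hk : k ≤ polyDim F) :
    linSpan (B.proj k '' F) = B.flag k := by
  rw [linSpan_proj_image]
  refine le_antisymm ?_ fun y hy => ?_
  · rintro _ ⟨x, -, rfl⟩
    exact B.proj_mem_flag k x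
  · obtain ⟨x, hx, e⟩ := h.exists_preimage hk hy
    exact ⟨x, hx, e⟩

theorem IsRegular.polyDim_proj_of_le (h : B.IsRegular F) {k : ℕ} (hk : k ≤ polyDim F) :
    polyDim (B.proj k '' F) = k := by
  rw [polyDim, h.linSpan_proj hk, B.finrank_flag (hk.trans (polyDim_le F))]

theorem IsRegular.injOn_proj (h : B.IsRegular F) {k : ℕ} (hk : polyDim F ≤ k) :
    Set.InjOn (B.proj k) (linSpan F) := fun x hx y hy e =>
  h.ext hx hy (by rw [← B.proj_proj_of_le hk x, e, B.proj_proj_of_le hk])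

theorem IsRegular.polyDim_proj_of_ge (h : B.IsRegular F) {k : ℕ} (hk : polyDim F ≤ k) :
    polyDim (B.proj k '' F) = polyDim F := by
  rw [polyDim, linSpan_proj_image]
  have := LinearMap.finrank_range_of_inj (f := (B.proj k).domRestrict (linSpan F))
    fun x y e => Subtype.ext (h.injOn_proj hk x.2 y.2 e)
  rwa [LinearMap.range_domRestrict] at this

theorem IsRegular.proj_of_le (h : B.IsRegular F) {k : ℕ} (hk : k ≤ polyDim F) :
    B.IsRegular (B.proj k '' F) := by
  rw [IsRegular, h.polyDim_proj_of_le hk, h.linSpan_proj hk]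
  refine (Set.bijOn_id _).congr fun x hx => ?_
  rw [B.mem_flag_iff.1 hx, id]

theorem IsRegular.proj_of_ge (h : B.IsRegular F) {k : ℕ} (hk : polyDim F ≤ k) :
    B.IsRegular (B.proj k '' F) := by
  rw [IsRegular, h.polyDim_proj_of_ge hk, linSpan_proj_image]
  refine ⟨fun y _ => B.proj_mem_flag _ y, ?_, fun y hy => ?_⟩
  · rintro _ ⟨x, hx, rfl⟩ _ ⟨y, hy, rfl⟩ e
    rw [B.proj_proj_of_le hk, B.proj_proj_of_le hk] at e
    rw [h.ext hx hy e]
  · obtain ⟨x, hx, e⟩ := h.surjOn hy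
    exact ⟨_, ⟨x, hx, rfl⟩, by rw [B.proj_proj_of_le hk, e]⟩

/-- Allows source and target conditions on projected polytopes to be tested on the original faces.
-/
theorem IsRegular.height_proj_image (h : B.IsRegular F) (hd : polyDim F < d) {k : ℕ}
    (hk : polyDim F < k) : B.height (B.proj k '' F) = B.height F := by
  have hdim := h.polyDim_proj_of_ge hk.le
  refine ((h.proj_of_ge hk.le).height_unique (by omega) ?_ ?_ ?_).symm
  · intro x
    rw [hdim, h.height_proj (Nat.lt_succ_self _)]
  · intro x hx
    rw [linSpan_proj_image] at hx
    obtain ⟨y, hy, rfl⟩ := hx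
    rw [h.height_proj hk, h.height_eq_zero hy]
  · have : (⟨polyDim (B.proj k '' F), by omega⟩ : Fin d) = ⟨polyDim F, hd⟩ := Fin.ext hdim
    rw [this, h.height_basis]

end Linear

end Frame

/-! ## Orientations -/

section Wedge

variable {M : Type*} [AddCommGroup M] [Module ℝ M]

theorem ιMulti_mul_ι {k : ℕ} (x : Fin k → M) (u : M) :
    ExteriorAlgebra.ιMulti ℝ k x * ExteriorAlgebra.ι ℝ u =
      ExteriorAlgebra.ιMulti ℝ (k + 1) (Fin.snoc (α := fun _ => M) x u) := by
  rw [ExteriorAlgebra.ιMulti_apply, ExteriorAlgebra.ιMulti_apply, List.ofFn_succ']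
  simp

theorem ιMulti_mul_ι_eq_zero {k : ℕ} (x : Fin k → M) (i : Fin k) :
    ExteriorAlgebra.ιMulti ℝ k x * ExteriorAlgebra.ι ℝ (x i) = 0 := by
  rw [ιMulti_mul_ι]
  exact AlternatingMap.map_eq_zero_of_eq _ _ (i := i.castSucc) (j := Fin.last k) (by simp)
    (Fin.castSucc_lt_last i).ne

theorem ι_mul_ιMulti_mul_ι {k : ℕ} (x : Fin k → M) (u : M) :
    ExteriorAlgebra.ι ℝ u * (ExteriorAlgebra.ιMulti ℝ k x * ExteriorAlgebra.ι ℝ u) = 0 := by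
  have h := ιMulti_mul_ι_eq_zero (Matrix.vecCons u x) 0
  rw [ExteriorAlgebra.ιMulti_succ_apply] at h
  simpa [mul_assoc] using h

/-- Multiples of `u` are invisible once the product is multiplied by `u`; the induction peels off
the first factor. -/
theorem ιMulti_add_smul_mul_ι (u : M) : ∀ {k : ℕ} (x : Fin k → M) (c : Fin k → ℝ),
    ExteriorAlgebra.ιMulti ℝ k (fun i => x i + c i • u) * ExteriorAlgebra.ι ℝ u =
      ExteriorAlgebra.ιMulti ℝ k x * ExteriorAlgebra.ι ℝ u
  | 0, x, c => by simp [ExteriorAlgebra.ιMulti_apply]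
  | k + 1, x, c => by
    have ih := ιMulti_add_smul_mul_ι u (Matrix.vecTail x) (Matrix.vecTail c)
    have ht : Matrix.vecTail (fun i => x i + c i • u) =
        fun i => Matrix.vecTail x i + Matrix.vecTail c i • u := rfl
    rw [ExteriorAlgebra.ιMulti_succ_apply, ExteriorAlgebra.ιMulti_succ_apply, ht, mul_assoc, ih,
      map_add, map_smul, add_mul, smul_mul_assoc, ι_mul_ιMulti_mul_ι, smul_zero, add_zero,
      mul_assoc]

end Wedge

namespace Frame

section Orientation

variable {d : ℕ} {B : Frame d} {E F : Set (Fin d → ℝ)}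

theorem IsRegular.orient_eq (h : B.IsRegular F) {n : ℕ} (hn : polyDim F = n) (hd : n ≤ d) :
    B.orient F = ExteriorAlgebra.ιMulti ℝ n fun i => B.sectionMap F (B (Fin.castLE hd i)) := by
  subst hn
  rw [orient]
  congr 1
  funext i
  exact h.sect_eq (B.basis_mem_flag i.2)

/-- The determinant of the first `k` coordinates, `k = dim F`, takes the value one on the
orientation, because the section map preserves these coordinates. -/
theorem IsRegular.orient_ne_zero (h : B.IsRegular F) : B.orient F ≠ 0 := by
  intro h0
  let g : (n : ℕ) → (Fin d → ℝ) [⋀^Fin n]→ₗ[ℝ] ℝ := fun n =>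
    Matrix.detRowAlternating.compLinearMap
      (LinearMap.pi fun i : Fin n => (B.coordinate i : (Fin d → ℝ) →ₗ[ℝ] ℝ))
  have h1 : ExteriorAlgebra.liftAlternating g (B.orient F) = 1 := by
    rw [h.orient_eq rfl (polyDim_le F), ExteriorAlgebra.liftAlternating_apply_ιMulti]
    change Matrix.det (Matrix.of fun i j : Fin (polyDim F) =>
      B.coordinate j (B.sectionMap F (B (Fin.castLE (polyDim_le F) i)))) = 1
    rw [← Matrix.det_one (n := Fin (polyDim F))]
    congr 1
    ext i j
    change B.coordinate j (B.sectionMap F _) = _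
    rw [← B.coordinate_proj j.2, h.proj_sectionMap, B.coordinate_proj j.2,
      B.coordinate_apply (j.2.trans_le (polyDim_le F)), B.repr_self, Finsupp.single_apply,
      Matrix.one_apply]
    simp [Fin.ext_iff]
  rw [h0, map_zero] at h1
  exact zero_ne_one h1

theorem IsRegular.orient_mul_ι_eq_zero (h : B.IsRegular E) {w : Fin d → ℝ} (hw : w ∈ linSpan E) :
    B.orient E * ExteriorAlgebra.ι ℝ w = 0 := by
  have key : LinearMap.mulLeft ℝ (B.orient E) ∘ₗ ExteriorAlgebra.ι ℝ ∘ₗ B.sectionMap E = 0 := by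
    refine B.ext fun i => ?_
    simp only [LinearMap.coe_comp, Function.comp_apply, LinearMap.mulLeft_apply,
      LinearMap.zero_apply]
    rcases lt_or_ge i.val (polyDim E) with hi | hi
    · rw [h.orient_eq rfl (polyDim_le E)]
      exact ιMulti_mul_ι_eq_zero (fun i => B.sectionMap E (B (Fin.castLE (polyDim_le E) i)))
        ⟨i, hi⟩
    · rw [h.sectionMap_basis_of_le hi, map_zero, mul_zero]
  have := LinearMap.congr_fun key w
  simpa [h.sectionMap_eq hw rfl] using this

section Codimension

variable (hE : B.IsRegular E) (hF : B.IsRegular F) (hle : linSpan E ≤ linSpan F)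
  (hdim : polyDim F = polyDim E + 1) (hd : polyDim E < d)

include hE hF hle hdim

/-- `Lin F` is `Lin E` plus the line through the lift of the next frame vector, and the height is
the coefficient along it. Both sides are compared under the injective projection of `Lin F`. -/
theorem IsRegular.eq_sectionMap_add {v : Fin d → ℝ} (hv : v ∈ linSpan F) :
    v = B.sectionMap E v + B.height E v • B.sectionMap F (B ⟨polyDim E, hd⟩) := by
  refine hF.ext hv (add_mem (hle (hE.sectionMap_mem v))
    (Submodule.smul_mem _ _ (hF.sectionMap_mem _))) ?_
  rw [map_add, map_smul, hF.proj_sectionMap, ← sub_eq_iff_eq_add', ← map_sub, hdim,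
    hE.proj_sub_sectionMap hd,
    B.proj_basis_of_lt (i := ⟨polyDim E, hd⟩) (Nat.lt_succ_self (polyDim E))]

/-- Each lift to `Lin F` of one of the first `dim E` frame vectors differs from its lift to `Lin E`
by a multiple of the last lift `u`, so `β_F = β_E ∧ u`; the component of `v` in `Lin E` is killed by
`β_E`. Orientation conditions thereby become signs of heights. -/
theorem IsRegular.orient_mul_ι {v : Fin d → ℝ} (hv : v ∈ linSpan F) :
    B.orient E * ExteriorAlgebra.ι ℝ v = B.height E v • B.orient F := by
  have hd : polyDim E < d := by have := polyDim_le F; omega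
  set u := B.sectionMap F (B ⟨polyDim E, hd⟩) with hu
  have hF' : B.orient F = B.orient E * ExteriorAlgebra.ι ℝ u := by
    rw [hF.orient_eq hdim hd, hE.orient_eq rfl hd.le]
    have hsnoc : (fun i : Fin (polyDim E + 1) => B.sectionMap F (B (Fin.castLE hd i))) =
        Fin.snoc (α := fun _ => Fin d → ℝ)
          (fun i : Fin (polyDim E) => B.sectionMap E (B (Fin.castLE hd.le i)) +
            B.height E (B.sectionMap F (B (Fin.castLE hd.le i))) • u) u := by
      funext i
      refine Fin.lastCases ?_ (fun i => ?_) i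
      · simp only [Fin.snoc_last]
        rfl
      · simp only [Fin.snoc_castSucc]
        have hi : B.sectionMap E (B.sectionMap F (B (Fin.castLE hd.le i))) =
            B.sectionMap E (B (Fin.castLE hd.le i)) := by
          refine (hE.sectionMap_eq (hE.sectionMap_mem _) ?_)
          rw [hE.proj_sectionMap, ← B.proj_proj_of_le (show polyDim E ≤ polyDim F by omega),
            hF.proj_sectionMap, B.proj_proj_of_le (by omega)]
        have := hE.eq_sectionMap_add hF hle hdim hd
          (hF.sectionMap_mem (B (Fin.castLE hd.le i)))
        rw [hi] at this
        exact this
    rw [hsnoc, ← ιMulti_mul_ι, ιMulti_add_smul_mul_ι]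
  have hsplit := hE.eq_sectionMap_add hF hle hdim hd hv
  rw [hF']
  conv_lhs => rw [hsplit]
  rw [map_add, map_smul, mul_add, hE.orient_mul_ι_eq_zero (hE.sectionMap_mem v), zero_add,
    mul_smul_comm]

end Codimension

/-- A facet is in the target (`s = 1`) or the source (`s = -1`) if and only if it is the locus of
maximal (minimal) height with respect to this facet. -/
theorem IsRegular.isSided_iff (hE : B.IsRegular E) (hF : B.IsRegular F) (hsub : E ⊆ F)
    (hne : E.Nonempty) (hdim : polyDim F = polyDim E + 1) {s : ℝ} (hs : s * s = 1) :
    (IsFacet F E ∧ ∃ v ∈ linSpan F, ∃ ψ ∈ normalCone F E,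
      0 < s * ψ v ∧ OrientEquiv (B.orient F) (B.orient E * ExteriorAlgebra.ι ℝ v)) ↔
      (s • B.height E).toExposed F = E := by
  have hle : linSpan E ≤ linSpan F := vectorSpan_mono ℝ hsub
  have hd : polyDim E < d := by have := polyDim_le F; omega
  obtain ⟨p, hp⟩ := hne
  constructor
  · rintro ⟨-, v, hv, ψ, hψ, hpos, c, hc, he⟩
    rw [hE.orient_mul_ι hF hle hdim hv, smul_smul] at he
    -- As `β_F ≠ 0`, coefficients can be compared; since `c > 0`, the vector `v` has positive
    -- height.
    have hcv : c * B.height E v = 1 := by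
      by_contra hne
      have : (1 - c * B.height E v) • B.orient F = 0 := by
        rw [sub_smul, one_smul, ← he, sub_self]
      rcases smul_eq_zero.1 this with h | h
      · exact hne (by linarith)
      · exact hF.orient_ne_zero h
    have hv0 : 0 < B.height E v := by
      by_contra h
      nlinarith
    set u := B.sectionMap F (B ⟨polyDim E, hd⟩) with hu
    -- `ψ` vanishes on the hyperplane `Lin E` of `Lin F`, hence is proportional to the height there.
    have hψu : ∀ x ∈ linSpan F, ψ x = ψ u * B.height E x := by
      intro x hx
      have := hE.eq_sectionMap_add hF hle hdim hd hx
      conv_lhs => rw [this]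
      rw [map_add, map_smul, toExposed_eq_zero hψ (hE.sectionMap_mem x), zero_add, smul_eq_mul,
        mul_comm]
    have hu0 : 0 < s * ψ u := by
      rw [hψu v hv, ← mul_assoc] at hpos
      exact (pos_iff_pos_of_mul_pos hpos).2 hv0
    obtain ⟨h1, h2, h3⟩ := (toExposed_eq_iff hp).1 hψ
    have key : ∀ x ∈ F, ψ x - ψ p = (s * ψ u) * (s * B.height E x - s * B.height E p) := by
      intro x hx
      rw [← map_sub, hψu _ (sub_mem_linSpan hx (hsub hp)), map_sub]
      linear_combination (-(ψ u * (B.height E x - B.height E p))) * hs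
    refine (toExposed_eq_iff hp).2 ⟨h1, fun x hx => ?_, fun x hx => ?_⟩
    · simp only [smul_apply, smul_eq_mul]
      have h4 := key x hx
      have h5 := h2 x hx
      by_contra hlt
      have : 0 < s * B.height E x - s * B.height E p := by linarith
      have := mul_pos hu0 this
      linarith
    · rw [← h3 x hx, ← sub_eq_zero, ← sub_eq_zero (a := ψ x), key x hx, mul_eq_zero,
        or_iff_right hu0.ne']
      simp
  · intro h
    -- The transverse vector is the lift of the next frame vector, of height one; the exposing
    -- functional is the signed height.
    refine ⟨⟨IsFace.of_toExposed h ⟨p, hp⟩, hdim.symm⟩, B.sectionMap F (B ⟨polyDim E, hd⟩),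
      hF.sectionMap_mem _, s • B.height E, h, ?_, ?_⟩
    all_goals
      have hu : B.height E (B.sectionMap F (B ⟨polyDim E, hd⟩)) = 1 := by
        rw [← hE.height_proj (show polyDim E < polyDim F by omega), hF.proj_sectionMap,
          hE.height_proj (by omega), hE.height_basis]
    · simp [hu, hs]
    · refine ⟨1, one_pos, ?_⟩
      rw [hE.orient_mul_ι hF hle hdim (hF.sectionMap_mem _), hu, one_smul, one_smul]

theorem IsRegular.isTarget_iff (hE : B.IsRegular E) (hF : B.IsRegular F) (hsub : E ⊆ F)
    (hne : E.Nonempty) (hdim : polyDim F = polyDim E + 1) :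
    IsTarget B.orient F E ↔ ((1 : ℝ) • B.height E).toExposed F = E := by
  rw [← hE.isSided_iff hF hsub hne hdim (one_mul 1)]
  simp [IsTarget]

theorem IsRegular.isSource_iff (hE : B.IsRegular E) (hF : B.IsRegular F) (hsub : E ⊆ F)
    (hne : E.Nonempty) (hdim : polyDim F = polyDim E + 1) :
    IsSource B.orient F E ↔ ((-1 : ℝ) • B.height E).toExposed F = E := by
  rw [← hE.isSided_iff hF hsub hne hdim (by norm_num)]
  simp [IsSource]

end Orientation

end Frame

/-! ## Iterated sources and targets -/

namespace Frame

section Extremal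

variable {d : ℕ} {B : Frame d} {E F G : Set (Fin d → ℝ)} {s r : ℝ}

variable (B) in
/-- The proper face `E` of `F` is the locus of maximal (`s = 1`) or minimal (`s = -1`) height
with respect to `E`. -/
def IsExtremal (s : ℝ) (F E : Set (Fin d → ℝ)) : Prop :=
  IsFace F E ∧ polyDim E < polyDim F ∧ (s • B.height E).toExposed F = E

theorem IsExtremal.le (h : B.IsExtremal s F E) {x p : Fin d → ℝ} (hx : x ∈ F) (hp : p ∈ E) :
    s * B.height E x ≤ s * B.height E p :=
  ((toExposed_eq_iff hp).1 h.2.2).2.1 x hx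

theorem IsExtremal.eq_iff (h : B.IsExtremal s F E) {x p : Fin d → ℝ} (hx : x ∈ F) (hp : p ∈ E) :
    s * B.height E x = s * B.height E p ↔ x ∈ E :=
  ((toExposed_eq_iff hp).1 h.2.2).2.2 x hx

theorem IsExtremal.lt (h : B.IsExtremal s F E) {x p : Fin d → ℝ} (hx : x ∈ F) (hp : p ∈ E)
    (hxE : x ∉ E) : s * B.height E x < s * B.height E p :=
  lt_of_le_of_ne (h.le hx hp) fun e => hxE ((h.eq_iff hx hp).1 e)

theorem IsExtremal.exists_notMem (h : B.IsExtremal s F E) : ∃ x ∈ F, x ∉ E := by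
  by_contra! hcon
  exact h.2.1.ne (congrArg polyDim (Set.Subset.antisymm h.1.subset hcon))

/-- The height is strictly smaller, up to the sign `s`, at some point of `F` outside `E`, so it
cannot be extremal on `E` in both directions. -/
theorem IsExtremal.not_neg (h : B.IsExtremal s F E) : ¬ B.IsExtremal (-s) F E := by
  intro h'
  obtain ⟨x, hx, hxE⟩ := h.exists_notMem
  obtain ⟨p, hp⟩ := h.1.1
  have := h.lt hx hp hxE
  have := h'.lt hx hp hxE
  linarith

theorem IsAdmissible.of_isFace (hB : B.IsAdmissible F) (hF : IsPolytope F) (hE : IsFace F E) :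
    B.IsAdmissible E := fun G hG => hB G (hE.trans hF hG)

theorem IsAdmissible.isRegular_face (hB : B.IsAdmissible F) (hE : IsFace F E) : B.IsRegular E :=
  hB E hE

theorem IsAdmissible.isRegular (hB : B.IsAdmissible F) (hF : F.Nonempty) : B.IsRegular F :=
  hB F (isFace_self hF)

/-- The locus of extremal height contains `E`, and its dimension is no larger because the height is
nonzero at the next frame vector. Thus attaining the extremum somewhere on `E` suffices. -/
theorem IsAdmissible.isExtremal_of_le (hB : B.IsAdmissible F) (hE : IsFace F E)
    (hdim : polyDim E < polyDim F) (hs : s ≠ 0) {p : Fin d → ℝ} (hp : p ∈ E)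
    (hle : ∀ x ∈ F, s * B.height E x ≤ s * B.height E p) : B.IsExtremal s F E := by
  have hEr : B.IsRegular E := hB.isRegular_face hE
  have hd : polyDim E < d := hdim.trans_le (polyDim_le F)
  refine ⟨hE, hdim, ?_⟩
  set G := (s • B.height E).toExposed F with hG
  have hEG : E ⊆ G := fun x hx => ⟨hE.subset hx, fun y hy => by
    have h1 := hle y hy
    rw [apply_eq_of_linSpan (fun w hw => hEr.height_eq_zero hw) hp hx] at h1
    exact h1⟩
  have hGF : IsFace F G := IsFace.of_toExposed hG.symm ⟨p, hEG hp⟩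
  refine hE.eq_of_subset hEG hGF.subset
    ((hB.isRegular_face hGF).polyDim_le_of_eq_zero hd
      (fun x => hEr.height_proj (Nat.lt_succ_self _) x) (fun x hx => ?_) ?_)
  · have := toExposed_eq_zero hG.symm hx
    simpa [hs] using this
  · rw [hEr.height_basis hd]
    exact one_ne_zero

theorem toExposed_proj_image {f : StrongDual ℝ (Fin d → ℝ)} {k : ℕ}
    (hf : ∀ x, f (B.proj k x) = f x) (h : f.toExposed F = E) :
    f.toExposed (B.proj k '' F) = B.proj k '' E := by
  subst h
  ext y
  constructor
  · rintro ⟨⟨x, hx, rfl⟩, hy⟩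
    refine ⟨x, ⟨hx, fun z hz => ?_⟩, rfl⟩
    have := hy _ ⟨z, hz, rfl⟩
    rwa [hf, hf] at this
  · rintro ⟨x, ⟨hx, hm⟩, rfl⟩
    refine ⟨⟨x, hx, rfl⟩, ?_⟩
    rintro _ ⟨z, hz, rfl⟩
    rw [hf, hf]
    exact hm z hz

theorem IsKBoundary.lt_polyDim (hB : B.IsAdmissible F) {k : ℕ} (h : B.IsKBoundary k F E) :
    k < polyDim F := by
  obtain ⟨hE, rfl, -, hdim⟩ := h
  rw [(hB.isRegular_face hE).polyDim_proj_of_ge (Nat.le_succ _)] at hdim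
  have h2 : polyDim (B.proj (polyDim E + 1) '' F) ≤ polyDim F := by
    rw [polyDim, linSpan_proj_image]
    exact Submodule.finrank_map_le _ _
  omega

/-- Iterated sources and targets are the faces of extremal height. -/
theorem IsAdmissible.isKSided_iff (hB : B.IsAdmissible F) (hs : s ≠ 0) {k : ℕ} :
    B.IsKBoundary k F E ∧
      (s • B.height (B.proj (k + 1) '' E)).toExposed (B.proj (k + 1) '' F) =
        B.proj (k + 1) '' E ↔
      polyDim E = k ∧ B.IsExtremal s F E := by
  constructor
  · rintro ⟨hb, h⟩
    have hlt := hb.lt_polyDim hB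
    obtain ⟨hE, rfl, -⟩ := hb
    have hEr : B.IsRegular E := hB.isRegular_face hE
    have hd : polyDim E < d := hlt.trans_le (polyDim_le F)
    rw [hEr.height_proj_image hd (Nat.lt_succ_self _)] at h
    obtain ⟨p, hp⟩ := hE.1
    refine ⟨rfl, hB.isExtremal_of_le hE hlt hs hp fun x hx => ?_⟩
    have := ((toExposed_eq_iff (Set.mem_image_of_mem _ hp)).1 h).2.1 _ ⟨x, hx, rfl⟩
    simpa [hEr.height_proj (Nat.lt_succ_self _)] using this
  · rintro ⟨rfl, hE, hlt, h⟩
    have hEr : B.IsRegular E := hB.isRegular_face hE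
    have hd : polyDim E < d := hlt.trans_le (polyDim_le F)
    have hex := toExposed_proj_image (B := B) (k := polyDim E + 1)
      (fun x => by simp [hEr.height_proj (Nat.lt_succ_self _)]) h
    rw [hEr.height_proj_image hd (Nat.lt_succ_self _)]
    refine ⟨⟨hE, rfl, IsFace.of_toExposed hex (hE.1.image _), ?_⟩, hex⟩
    rw [hEr.polyDim_proj_of_ge (Nat.le_succ _),
      (hB.isRegular (hE.1.mono hE.subset)).polyDim_proj_of_le hlt]

section KSided

variable (hB : B.IsAdmissible F) {k : ℕ}
include hB

theorem IsKBoundary.regular_proj (h : B.IsKBoundary k F E) :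
    B.IsRegular (B.proj (k + 1) '' E) ∧ B.IsRegular (B.proj (k + 1) '' F) ∧
      B.proj (k + 1) '' E ⊆ B.proj (k + 1) '' F ∧ (B.proj (k + 1) '' E).Nonempty := by
  have hlt := h.lt_polyDim hB
  obtain ⟨hE, rfl, -⟩ := h
  exact ⟨(hB.isRegular_face hE).proj_of_ge (Nat.le_succ _),
    (hB.isRegular (hE.1.mono hE.subset)).proj_of_le hlt, Set.image_mono hE.subset, hE.1.image _⟩

theorem IsAdmissible.isKTarget_iff :
    B.IsKTarget k F E ↔ polyDim E = k ∧ B.IsExtremal 1 F E := by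
  rw [← hB.isKSided_iff one_ne_zero]
  refine and_congr_right fun h => ?_
  obtain ⟨h1, h2, h3, h4⟩ := h.regular_proj hB
  exact h1.isTarget_iff h2 h3 h4 h.2.2.2.symm

theorem IsAdmissible.isKSource_iff :
    B.IsKSource k F E ↔ polyDim E = k ∧ B.IsExtremal (-1) F E := by
  rw [← hB.isKSided_iff (by norm_num)]
  refine and_congr_right fun h => ?_
  obtain ⟨h1, h2, h3, h4⟩ := h.regular_proj hB
  exact h1.isSource_iff h2 h3 h4 h.2.2.2.symm

end KSided

theorem IsAdmissible.isTarget_iff (hB : B.IsAdmissible F) :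
    IsTarget B.orient F E ↔ polyDim F = polyDim E + 1 ∧ B.IsExtremal 1 F E := by
  constructor
  · intro h
    have hE := h.1.1
    have hdim := h.1.2.symm
    exact ⟨hdim, hE, by omega, ((hB.isRegular_face hE).isTarget_iff
      (hB.isRegular (hE.1.mono hE.subset)) hE.subset hE.1 hdim).1 h⟩
  · rintro ⟨hdim, hE, -, h⟩
    exact ((hB.isRegular_face hE).isTarget_iff
      (hB.isRegular (hE.1.mono hE.subset)) hE.subset hE.1 hdim).2 h

theorem IsAdmissible.isSource_iff (hB : B.IsAdmissible F) :
    IsSource B.orient F E ↔ polyDim F = polyDim E + 1 ∧ B.IsExtremal (-1) F E := by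
  constructor
  · intro h
    have hE := h.1.1
    have hdim := h.1.2.symm
    exact ⟨hdim, hE, by omega, ((hB.isRegular_face hE).isSource_iff
      (hB.isRegular (hE.1.mono hE.subset)) hE.subset hE.1 hdim).1 h⟩
  · rintro ⟨hdim, hE, -, h⟩
    exact ((hB.isRegular_face hE).isSource_iff
      (hB.isRegular (hE.1.mono hE.subset)) hE.subset hE.1 hdim).2 h

/-! ### The faces of dimension one more around a face -/

variable (B) in
/-- The face `G` of dimension `k` projects to a vertex of the upper (`s = 1`) or lower (`s = -1`)
boundary of the polygon obtained from `π_{k+2}(F)` by collapsing `Lin G`. -/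
def IsBoundaryVertex (s : ℝ) (F G : Set (Fin d → ℝ)) : Prop :=
  ∃ c : ℝ, (s • B.displacement G (polyDim G + 1) + c • B.height G).toExposed F = G

section Star

variable (hP : IsPolytope F) (hB : B.IsAdmissible F)

include hB in
-- In the polygon around `G`, the face `E` lies on a line through the point `G`; `m` is the slope
-- parameter of this line.
theorem IsAdmissible.exists_height_eq (hE : IsFace F E) (hG : IsFace F G)
    (hle : linSpan G ≤ linSpan E) (hdim : polyDim E = polyDim G + 1) (hlt : polyDim E < polyDim F) :
    ∃ m : ℝ, ∀ x, B.height E x = B.displacement G (polyDim G + 1) x + m * B.height G x := by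
  have hEr : B.IsRegular E := hB.isRegular_face hE
  have hd : polyDim E < d := hlt.trans_le (polyDim_le F)
  refine ⟨B.height E (B ⟨polyDim G, by omega⟩), fun x => ?_⟩
  have h1 := hEr.height_basis hd
  have h2 : (⟨polyDim E, hd⟩ : Fin d) = ⟨polyDim G + 1, by omega⟩ := Fin.ext hdim
  rw [h2] at h1
  rw [(hB.isRegular_face hG).eq_displacement (by omega) (f := B.height E)
    (fun x => hEr.height_proj (by omega) x) (fun x hx => hEr.height_eq_zero (hle hx)) x, h1]
  ring

include hP hB in
-- Maximize first the signed height of `E`, then that of `G`: an end of an upper edge is an upper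
-- vertex.
theorem IsExtremal.isBoundaryVertex_of_isExtremal (hE : B.IsExtremal s F E)
    (hG : B.IsExtremal r E G) (hdim : polyDim E = polyDim G + 1) : B.IsBoundaryVertex s F G := by
  have hGF := hE.1.trans hP hG.1
  obtain ⟨m, hm⟩ := hB.exists_height_eq hE.1 hGF hG.1.linSpan_le hdim hE.2.1
  obtain ⟨N, hN, h⟩ := hP.exists_toExposed_smul_add hE.2.2 hG.2.2 hG.1.1 (hGF.convex hP)
  -- Dividing the combined functional by `N` makes the coefficient of the displacement equal to `s`.
  refine ⟨s * m + N⁻¹ * r, ?_⟩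
  refine (toExposed_smul hN).symm.trans (Eq.trans ?_ h)
  congr 1
  ext1 x
  simp only [add_apply, smul_apply, smul_eq_mul, hm]
  field_simp
  ring

include hP hB in
-- The ends of the polygon lie on both boundary paths: the height already exposes `G`, and the
-- displacement, constant on `G`, is only a small perturbation.
theorem IsExtremal.isBoundaryVertex (hG : B.IsExtremal r F G) :
    B.IsBoundaryVertex s F G := by
  have hGr : B.IsRegular G := hB.isRegular_face hG.1
  have hc : (s • B.displacement G (polyDim G + 1)).toExposed G = G := by
    ext x
    refine ⟨fun h => h.1, fun hx => ⟨hx, fun y hy => ?_⟩⟩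
    refine (apply_eq_of_linSpan (E := G) (fun w hw => ?_) hy hx).le
    simp [hGr.displacement_eq_zero hw]
  obtain ⟨N, hN, h⟩ := hP.exists_toExposed_smul_add hG.2.2 hc hG.1.1 (hG.1.convex hP)
  refine ⟨N * r, ?_⟩
  rw [add_comm, mul_smul]
  exact h

include hP hB in
/-- A vertex of the upper boundary which is not extremal on one side is the endpoint of an edge
on this side. -/
theorem IsBoundaryVertex.exists_isExtremal (hU : B.IsBoundaryVertex s F G) (hG : IsFace F G)
    (hdim : polyDim G + 1 < polyDim F) (hs : s * s = 1) (hr : r * r = 1)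
    (hnot : ¬ B.IsExtremal (-r) F G) :
    ∃ E, polyDim E = polyDim G + 1 ∧ B.IsExtremal s F E ∧ B.IsExtremal r E G := by
  have hGr : B.IsRegular G := hB.isRegular_face hG
  have hd : polyDim G + 1 < d := hdim.trans_le (polyDim_le F)
  have hGc := hG.convex hP
  have hr0 : r ≠ 0 := by rintro rfl; simp at hr
  obtain ⟨p, hp⟩ := hG.1
  obtain ⟨c, hc⟩ := hU
  obtain ⟨u1, u2, u3⟩ := (toExposed_eq_iff hp).1 hc
  set θ := B.height G with hθ
  set θ' := B.displacement G (polyDim G + 1) with hθ'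
  have hθG : ∀ x ∈ G, θ x = θ p := fun x hx =>
    apply_eq_of_linSpan (fun w hw => hGr.height_eq_zero hw) hx hp
  have hθ'G : ∀ x ∈ G, θ' x = θ' p := fun x hx =>
    apply_eq_of_linSpan (fun w hw => hGr.displacement_eq_zero hw) hx hp
  have hx0 : ∃ x ∈ F, r * θ x < r * θ p := by
    by_contra! hcon
    refine hnot (hB.isExtremal_of_le hG (by omega) (neg_ne_zero.2 hr0) hp fun x hx => ?_)
    have := hcon x hx
    rw [neg_mul, neg_mul]
    exact neg_le_neg this
  obtain ⟨S, hS, hFS⟩ := hP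
  -- `T` collects the generators strictly on the side where the edge is sought; it is nonempty
  -- because `G` is not the end of the polygon on that side.
  obtain ⟨T, hT⟩ : ∃ T : Set (Fin d → ℝ), T = {y ∈ S | r * θ y < r * θ p} := ⟨_, rfl⟩
  have hTne : T.Nonempty := by
    by_contra hemp
    obtain ⟨x, hx, hlt⟩ := hx0
    have hsub : F ⊆ {x | r * θ p ≤ (r • θ) x} := by
      rw [hFS]
      refine convexHull_min (fun y hy => ?_)
        (convex_halfSpace_ge (r • θ).isLinear _)
      by_contra hy'
      exact hemp ⟨y, hT ▸ ⟨hy, not_le.1 hy'⟩⟩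
    exact absurd (hsub hx) (not_le.2 hlt)
  have hSF : S ⊆ F := hFS ▸ subset_convexHull ℝ S
  have hstrict : ∀ x ∈ F, x ∉ G → s * (θ' x - θ' p) + c * r * (r * θ x - r * θ p) < 0 := by
    intro x hx hxG
    have h1 := lt_of_le_of_ne (u2 x hx) fun e => hxG ((u3 x hx).1 e)
    simp only [add_apply, smul_apply, smul_eq_mul] at h1
    have : c * r * (r * θ x - r * θ p) = c * (θ x - θ p) := by
      linear_combination c * (θ x - θ p) * hr
    rw [this]
    linarith
  -- The supporting line at `G` is rotated: the coefficient of `r * θ` decreases from `c * r` until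
  -- a generator in `T` first reaches the level of `p`. The largest such value `t` is the slope of
  -- the edge, attained at `y`.
  obtain ⟨y, hy, hmax⟩ := (hS.subset (hT ▸ fun x hx => hx.1 : T ⊆ S)).exists_maximalFor
    (fun y => -(s * (θ' y - θ' p)) / (r * θ y - r * θ p)) T hTne
  set t := -(s * (θ' y - θ' p)) / (r * θ y - r * θ p) with ht
  have hTG : ∀ z ∈ T, z ∈ S ∧ r * θ z - r * θ p < 0 ∧ z ∉ G := by
    intro z hz
    rw [hT] at hz
    refine ⟨hz.1, sub_neg.2 hz.2, fun hzG => ?_⟩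
    have := hz.2
    rw [hθG z hzG] at this
    exact lt_irrefl _ this
  have hyeq : s * (θ' y - θ' p) + t * (r * θ y - r * θ p) = 0 := by
    rw [ht, div_mul_cancel₀ _ (hTG y hy).2.1.ne]
    ring
  have htc : t < c * r := by
    have h1 := hstrict y (hSF (hTG y hy).1) (hTG y hy).2.2
    rw [ht, div_lt_iff_of_neg (hTG y hy).2.1]
    linarith
  have hTle : ∀ z ∈ T, s * (θ' z - θ' p) + t * (r * θ z - r * θ p) ≤ 0 := by
    intro z hz
    have h1 : -(s * (θ' z - θ' p)) / (r * θ z - r * θ p) ≤ t :=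
      (le_total _ _).elim id fun h => hmax hz h
    rw [div_le_iff_of_neg (hTG z hz).2.1] at h1
    linarith
  set f : StrongDual ℝ (Fin d → ℝ) := s • θ' + (t * r) • θ with hf
  have hfx : ∀ x, f x - f p = s * (θ' x - θ' p) + t * (r * θ x - r * θ p) := by
    intro x
    simp only [hf, add_apply, smul_apply, smul_eq_mul]
    ring
  -- Besides the level of `f`, `K` records that points outside `G` lie strictly on the chosen side,
  -- so that `G` will be an end of the new face.
  set K : Set (Fin d → ℝ) := {x | f x = f p} ∩ ({x | (r • θ) x < (r • θ) p} ∪ G) with hK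
  have hKc : Convex ℝ K :=
    (convex_hyperplane f.isLinear _).inter (convex_lt_union hGc fun x hx => by simp [hθG x hx])
  have hGK : G ⊆ K := fun x hx => ⟨by simp [hf, hθG x hx, hθ'G x hx], Or.inr hx⟩
  have hE : f.toExposed F = F ∩ K := by
    rw [hFS]
    refine toExposed_convexHull (p := p) ((convex_convexHull ℝ S).inter hKc)
      ⟨hFS ▸ hG.subset hp, hGK hp⟩ Set.inter_subset_left (fun x hx => hx.2.1) fun x hx hxK => ?_
    by_cases hxT : x ∈ T
    · refine lt_of_le_of_ne (by linarith [hTle x hxT, hfx x]) fun e => hxK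
        ⟨subset_convexHull ℝ S hx, e, Or.inl ?_⟩
      have := (hTG x hxT).2.1
      simpa using this
    · have hxG : x ∉ G := fun h => hxK ⟨subset_convexHull ℝ S hx, hGK h⟩
      have h0 : 0 ≤ r * θ x - r * θ p := by
        by_contra h
        exact hxT (hT ▸ ⟨hx, by linarith⟩)
      -- On the other side, lowering the coefficient from `c * r` to `t` only decreases the
      -- functional, so strictness persists.
      have h1 := hstrict x (hSF hx) hxG
      have h2 := mul_le_mul_of_nonneg_right htc.le h0
      linarith [hfx x]
  set E := F ∩ K with hEdef
  have hGE : G ⊆ E := fun x hx => ⟨hG.subset hx, hGK hx⟩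
  have hEF : IsFace F E := IsFace.of_toExposed hE ⟨p, hGE hp⟩
  have hEr : B.IsRegular E := hB.isRegular_face hEF
  have hyE : y ∈ E := ⟨hSF (hTG y hy).1, by
    change f y = f p
    linarith [hfx y], Or.inl (by simpa using (hTG y hy).2.1)⟩
  have hf1 : f (B ⟨polyDim G + 1, hd⟩) = s := by
    simp only [hf, hθ, hθ', height, add_apply, smul_apply, smul_eq_mul]
    rw [hGr.displacement_basis (Nat.le_succ _), hGr.displacement_basis (Nat.le_succ _),
      B.coordinate_basis_self, B.coordinate_basis_ne hd (by omega)]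
    ring
  have hs0 : s ≠ 0 := by rintro rfl; simp at hs
  have hfproj : ∀ x, f (B.proj (polyDim G + 1 + 1) x) = f x := by
    intro x
    simp only [hf, hθ, hθ', height, add_apply, smul_apply]
    rw [hGr.displacement_proj (by omega) (by omega), hGr.displacement_proj (by omega) (by omega)]
  have hf0 : ∀ x ∈ linSpan E, f x = 0 := fun x hx => toExposed_eq_zero hE hx
  -- The upper bound holds because `f` is nonzero at `v_{k+2}`, `k = dim G`; the lower one because
  -- `y` lies in `E` but not in `G`.
  have hEdim : polyDim E = polyDim G + 1 := by
    refine le_antisymm (hEr.polyDim_le_of_eq_zero hd hfproj hf0 (hf1 ▸ hs0)) ?_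
    by_contra hlt
    have := hG.eq_of_subset hGE hEF.subset (by omega)
    exact (hTG y hy).2.2 (this ▸ hyE)
  have hheight : s • f = B.height E := by
    refine hEr.height_unique (by omega) (fun x => ?_) (fun x hx => ?_) ?_
    · rw [hEdim, smul_apply, hfproj, smul_apply]
    · rw [smul_apply, hf0 x hx, smul_zero]
    · have : (⟨polyDim E, by omega⟩ : Fin d) = ⟨polyDim G + 1, hd⟩ := Fin.ext hEdim
      rw [this, smul_apply, hf1, smul_eq_mul, hs]
  have hGE' : (r • θ).toExposed E = G := by
    have hEle : ∀ x ∈ E, (r • θ) x < (r • θ) p ∨ x ∈ G := fun x hx => hx.2.2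
    refine (toExposed_eq_iff hp).2 ⟨hGE, fun x hx => ?_, fun x hx => ⟨fun e => ?_, fun h => ?_⟩⟩
    · rcases hEle x hx with h | h
      · exact h.le
      · simp [hθG x h]
    · rcases hEle x hx with h | h
      · exact absurd e h.ne
      · exact h
    · simp [hθG x h]
  refine ⟨E, hEdim, ⟨hEF, by omega, ?_⟩, IsFace.of_toExposed hGE' ⟨p, hp⟩, by omega, hGE'⟩
  rw [← hheight, smul_smul, hs, one_smul, hE]

include hP hB in
theorem IsAdmissible.exists_isExtremal_iff (hG : IsFace F G) (hdim : polyDim G + 1 < polyDim F)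
    (hs : s * s = 1) (hr : r * r = 1) :
    (∃ E, polyDim E = polyDim G + 1 ∧ B.IsExtremal s F E ∧ B.IsExtremal r E G) ↔
      B.IsBoundaryVertex s F G ∧ ¬ B.IsExtremal (-r) F G := by
  refine ⟨?_, fun ⟨hU, h⟩ => hU.exists_isExtremal hP hB hG hdim hs hr h⟩
  rintro ⟨E, hE, hsE, hrE⟩
  refine ⟨hsE.isBoundaryVertex_of_isExtremal hP hB hrE hE, fun h => ?_⟩
  obtain ⟨x, hx, hxG⟩ := hrE.exists_notMem
  obtain ⟨p, hp⟩ := hG.1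
  have h1 := hrE.lt hx hp hxG
  have h2 := h.le (hsE.1.subset hx) hp
  linarith

include hP hB in
-- A point of `E` outside `G` lies weakly below the line of `E'`, which compares the two slopes.
-- Exchanging the roles gives equality, so both faces are exposed by the same height.
theorem IsAdmissible.isExtremal_unique {E' : Set (Fin d → ℝ)} (hs : s * s = 1) (hr : r * r = 1)
    (hE : polyDim E = polyDim G + 1) (hsE : B.IsExtremal s F E) (hrE : B.IsExtremal r E G)
    (hE' : polyDim E' = polyDim G + 1) (hsE' : B.IsExtremal s F E')
    (hrE' : B.IsExtremal r E' G) : E = E' := by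
  have hG : IsFace F G := hsE.1.trans hP hrE.1
  obtain ⟨p, hp⟩ := hG.1
  have key : ∀ {E E' : Set (Fin d → ℝ)} {m m' : ℝ}, B.IsExtremal s F E → B.IsExtremal r E G →
      B.IsExtremal s F E' → B.IsExtremal r E' G →
      (∀ x, B.height E x = B.displacement G (polyDim G + 1) x + m * B.height G x) →
      (∀ x, B.height E' x = B.displacement G (polyDim G + 1) x + m' * B.height G x) →
      0 ≤ (s * r) * (m' - m) := by
    intro E E' m m' hsE hrE hsE' hrE' hm hm'
    obtain ⟨x, hx, hxG⟩ := hrE.exists_notMem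
    have h1 := hrE.lt hx hp hxG
    have h2 := (hsE.eq_iff (hsE.1.subset hx) (hrE.1.subset hp)).2 hx
    have h3 := hsE'.le (hsE.1.subset hx) (hrE'.1.subset hp)
    rw [hm, hm] at h2
    rw [hm', hm'] at h3
    by_contra hneg
    have h4 := mul_pos_of_neg_of_neg (not_le.1 hneg) (sub_neg.2 h1)
    have h5 : (s * r) * (m' - m) * (r * B.height G x - r * B.height G p) =
        s * (m' - m) * (B.height G x - B.height G p) := by
      linear_combination (s * (m' - m) * (B.height G x - B.height G p)) * hr
    rw [h5] at h4
    linarith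
  obtain ⟨m, hm⟩ := hB.exists_height_eq hsE.1 hG hrE.1.linSpan_le hE hsE.2.1
  obtain ⟨m', hm'⟩ := hB.exists_height_eq hsE'.1 hG hrE'.1.linSpan_le hE' hsE'.2.1
  have h1 := key hsE hrE hsE' hrE' hm hm'
  have h2 := key hsE' hrE' hsE hrE hm' hm
  have h3 : (s * r) * (m' - m) = 0 := by
    refine le_antisymm ?_ h1
    have : (s * r) * (m - m') = -((s * r) * (m' - m)) := by ring
    linarith
  have h4 : m' = m := by
    have : m' - m = (s * r) * ((s * r) * (m' - m)) := by
      linear_combination (-(m' - m) * (r * r)) * hs - (m' - m) * hr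
    rw [h3, mul_zero] at this
    linarith
  have h5 : B.height E = B.height E' := by
    ext1 x
    rw [hm, hm', h4]
  rw [← hsE.2.2, ← hsE'.2.2, h5]

include hP hB in
-- The end of the polygon on side `s` is not its opposite end, so an edge leaves it towards the
-- interior, on the upper path if `s = 1` and on the lower one if `s = -1`.
theorem IsExtremal.exists_between (hG : B.IsExtremal s F G) (hdim : polyDim G + 1 < polyDim F)
    (hs : s * s = 1) :
    ∃ E, polyDim E = polyDim G + 1 ∧ B.IsExtremal s F E ∧ B.IsExtremal s E G :=
  (hB.exists_isExtremal_iff hP hG.1 hdim hs hs).2 ⟨hG.isBoundaryVertex hP hB, hG.not_neg⟩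

end Star

/-! ### Vertices -/

theorem IsRegular.height_of_polyDim_eq_zero (h0 : polyDim E = 0) (h : B.IsRegular E) :
    B.height E = B.coordinate 0 := by
  ext1 x
  have hbot : linSpan E = ⊥ := Submodule.finrank_eq_zero.1 h0
  have hx := h.sectionMap_mem x
  rw [hbot, Submodule.mem_bot] at hx
  rw [height, displacement_apply, h0, hx, sub_zero]

/-- For vertices the height is always the first coordinate, so its extremal locus is the only
candidate; by admissibility this locus is a point. -/
theorem IsAdmissible.existsUnique_vertex (hP : IsPolytope F) (hB : B.IsAdmissible F)
    (hdim : 0 < polyDim F) (hs : s ≠ 0) :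
    ∃ E, (polyDim E = 0 ∧ B.IsExtremal s F E) ∧
      ∀ E', polyDim E' = 0 ∧ B.IsExtremal s F E' → E' = E := by
  have hne : F.Nonempty := by
    rw [Set.nonempty_iff_ne_empty]
    rintro rfl
    rw [polyDim, linSpan, vectorSpan_empty, finrank_bot] at hdim
    exact lt_irrefl _ hdim
  have hd : 0 < d := hdim.trans_le (polyDim_le F)
  have hcomp : IsCompact F := by
    obtain ⟨S, hS, rfl⟩ := hP
    exact hS.isCompact_convexHull ℝ
  obtain ⟨p, hp, hmax⟩ := hcomp.exists_isMaxOn hne (s • B.coordinate 0).continuous.continuousOn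
  set E := (s • B.coordinate 0).toExposed F with hE
  have hpE : p ∈ E := ⟨hp, fun y hy => hmax hy⟩
  have hEF : IsFace F E := IsFace.of_toExposed hE.symm ⟨p, hpE⟩
  have hEr : B.IsRegular E := hB.isRegular_face hEF
  have h0 : polyDim E = 0 := by
    refine Nat.le_zero.1 (hEr.polyDim_le_of_eq_zero hd (f := B.coordinate 0)
      (fun x => B.coordinate_proj (Nat.lt_succ_self _) x) (fun x hx => ?_) ?_)
    · have := toExposed_eq_zero hE.symm hx
      simpa [hs] using this
    · rw [B.coordinate_basis_self hd]
      exact one_ne_zero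
  refine ⟨E, ⟨h0, hEF, by omega, ?_⟩, fun E' ⟨h0', hE'⟩ => ?_⟩
  · rw [hEr.height_of_polyDim_eq_zero h0]
  · rw [← hE'.2.2, (hB.isRegular_face hE'.1).height_of_polyDim_eq_zero h0']

end Extremal

end Frame

/-! ## The chain complex -/

/-- The sign as a real number. -/
def PM.sign : PM → ℝ
  | .neg => -1
  | .pos => 1

theorem PM.sign_mul_self (s : PM) : s.sign * s.sign = 1 := by
  cases s <;> norm_num [PM.sign]

theorem PM.sign_ne_zero (s : PM) : s.sign ≠ 0 := by
  cases s <;> norm_num [PM.sign]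

namespace BasedAugmentedData

variable (C : BasedAugmentedData) (s : PM) {n : ℕ} (c : C.basis n →₀ ℤ)

theorem atom_self : C.atom s c le_rfl = c :=
  Nat.decreasingInduction_self _ _

theorem atom_of_lt {k : ℕ} (h : k < n) :
    C.atom s c h.le = C.bdPart s k (C.atom s c (Nat.succ_le_of_lt h)) :=
  Nat.decreasingInduction_succ_left _ _ _ _

end BasedAugmentedData

theorem ite_one_zero_ne_zero (p : Prop) [Decidable p] : (if p then (1 : ℤ) else 0) ≠ 0 ↔ p := by
  simp

/-! ### Sums of indicators and coefficients of linear maps -/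

section FiniteSums

variable {α β : Type*} [Fintype α]

open Classical in
theorem sum_ite_of_unique {p : α → Prop} [DecidablePred p] (h : ∀ a b, p a → p b → a = b) :
    ∑ a, (if p a then (1 : ℤ) else 0) = if ∃ a, p a then 1 else 0 := by
  by_cases hp : ∃ a, p a
  · obtain ⟨a, ha⟩ := hp
    rw [if_pos ⟨a, ha⟩, Finset.sum_eq_single a (fun b _ hb => if_neg fun hb' => hb (h b a hb' ha))
      (by simp), if_pos ha]
  · rw [if_neg hp]
    exact Finset.sum_eq_zero fun a _ => if_neg fun ha => hp ⟨a, ha⟩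

theorem sum_filter_single_apply (p : α → Prop) [DecidablePred p] (b : α) :
    (∑ a with p a, Finsupp.single a (1 : ℤ) : α →₀ ℤ) b = if p b then 1 else 0 := by
  classical
  simp [Finsupp.single_apply]

theorem linearMap_apply_eq_sum {M : Type*} [AddCommGroup M] (f : (α →₀ ℤ) →ₗ[ℤ] M) (c : α →₀ ℤ) :
    f c = ∑ a, c a • f (Finsupp.single a 1) := by
  conv_lhs => rw [← Finsupp.univ_sum_single c]
  rw [map_sum]
  refine Finset.sum_congr rfl fun a _ => ?_
  rw [← map_smul, Finsupp.smul_single_one]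

theorem linearMap_apply_apply_eq_sum (f : (α →₀ ℤ) →ₗ[ℤ] β →₀ ℤ) (c : α →₀ ℤ) (b : β) :
    f c b = ∑ a, c a * f (Finsupp.single a 1) b := by
  rw [linearMap_apply_eq_sum, Finsupp.finsetSum_apply]
  rfl

end FiniteSums

open Classical in
/-- The coefficient of `E` in the iterated boundary of `F`. -/
noncomputable def Frame.incidence {d : ℕ} (B : Frame d) (F E : Set (Fin d → ℝ)) : ℤ :=
  (if B.IsExtremal 1 F E then 1 else 0) - if B.IsExtremal (-1) F E then 1 else 0

/-! ### Boundary coefficients and iterated boundaries -/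

namespace FramedPolytope

variable {d : ℕ} (P : FramedPolytope d)

theorem isPolytope_of_isFace {F : Set (Fin d → ℝ)} (hF : IsFace P.carrier F) : IsPolytope F :=
  hF.isPolytope P.isPolytope

theorem isAdmissible_of_isFace {F : Set (Fin d → ℝ)} (hF : IsFace P.carrier F) :
    P.frame.IsAdmissible F :=
  P.admissible.of_isFace P.isPolytope hF

noncomputable instance (n : ℕ) : Fintype (P.chains.basis n) :=
  @Fintype.ofFinite (P.KFace n) _

/-- The face corresponding to a basis element of the chain complex. -/
def cell {n : ℕ} (F : P.chains.basis n) : Set (Fin d → ℝ) :=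
  Subtype.val (p := fun F => IsFace P.carrier F ∧ polyDim F = n) F

theorem isFace_cell {n : ℕ} (F : P.chains.basis n) : IsFace P.carrier (P.cell F) :=
  (Subtype.prop (p := fun F => IsFace P.carrier F ∧ polyDim F = n) F).1

theorem polyDim_cell {n : ℕ} (F : P.chains.basis n) : polyDim (P.cell F) = n :=
  (Subtype.prop (p := fun F => IsFace P.carrier F ∧ polyDim F = n) F).2

theorem cell_injective {n : ℕ} {F G : P.chains.basis n} (h : P.cell F = P.cell G) : F = G :=
  Subtype.ext h

theorem exists_cell_eq {n : ℕ} {F : Set (Fin d → ℝ)} (hF : IsFace P.carrier F)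
    (hn : polyDim F = n) : ∃ F' : P.chains.basis n, P.cell F' = F :=
  ⟨(⟨F, hF, hn⟩ : P.KFace n), rfl⟩

theorem bd_single_apply {n : ℕ} (F : P.chains.basis (n + 1)) (G : P.chains.basis n) :
    P.chains.bd n (Finsupp.single F 1) G = P.frame.incidence (P.cell F) (P.cell G) := by
  classical
  let _ : Fintype (P.KFace n) := Fintype.ofFinite _
  have hB := P.isAdmissible_of_isFace (P.isFace_cell F)
  have hdim : polyDim (P.cell F) = polyDim (P.cell G) + 1 := by
    rw [P.polyDim_cell, P.polyDim_cell]
  have h1 : P.chains.bd n (Finsupp.single F 1) =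
      ((∑ E : P.KFace n with IsTarget P.frame.orient (P.cell F) E.1, Finsupp.single E (1 : ℤ)) -
        ∑ E : P.KFace n with IsSource P.frame.orient (P.cell F) E.1, Finsupp.single E (1 : ℤ) :
          P.KFace n →₀ ℤ) := by
    refine (Finsupp.linearCombination_single (M := P.KFace n →₀ ℤ) ℤ (1 : ℤ) F).trans
      ((one_smul ℤ (_ : P.KFace n →₀ ℤ)).trans ?_)
    congr!
  have h2 := sum_filter_single_apply
    (fun E : P.KFace n => IsTarget P.frame.orient (P.cell F) E.1) G
  have h3 := sum_filter_single_apply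
    (fun E : P.KFace n => IsSource P.frame.orient (P.cell F) E.1) G
  have h4 : IsTarget P.frame.orient (P.cell F) (P.cell G) ↔
      P.frame.IsExtremal 1 (P.cell F) (P.cell G) := by
    rw [hB.isTarget_iff, and_iff_right hdim]
  have h5 : IsSource P.frame.orient (P.cell F) (P.cell G) ↔
      P.frame.IsExtremal (-1) (P.cell F) (P.cell G) := by
    rw [hB.isSource_iff, and_iff_right hdim]
  rw [h1, Frame.incidence]
  refine (congrArg₂ (· - ·) h2 h3).trans ?_
  exact congrArg₂ (· - ·) (if_congr h4 rfl rfl) (if_congr h5 rfl rfl)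

theorem bd_apply {n : ℕ} (c : P.chains.basis (n + 1) →₀ ℤ) (G : P.chains.basis n) :
    P.chains.bd n c G = ∑ E, c E * P.frame.incidence (P.cell E) (P.cell G) := by
  rw [linearMap_apply_apply_eq_sum]
  simp only [bd_single_apply]

theorem aug_single (b : P.chains.basis 0) : P.chains.aug (Finsupp.single b 1) = 1 :=
  (Finsupp.linearCombination_single ℤ (1 : ℤ) b).trans (one_smul ℤ _)

theorem aug_apply (c : P.chains.basis 0 →₀ ℤ) : P.chains.aug c = ∑ E, c E := by
  rw [linearMap_apply_eq_sum]
  simp only [aug_single, smul_eq_mul, mul_one]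

variable {P}

open Classical in
-- No face is extremal for both signs, so the two indicators in the incidence number do not cancel.
-- Assuming only the coefficient at `G` makes this usable for iterated boundaries as well as for
-- basis elements.
theorem bdPart_apply (s : PM) {n : ℕ} {c : P.chains.basis (n + 1) →₀ ℤ} {F : Set (Fin d → ℝ)}
    {G : P.chains.basis n} (h : P.chains.bd n c G = P.frame.incidence F (P.cell G)) :
    P.chains.bdPart s n c G = if P.frame.IsExtremal s.sign F (P.cell G) then 1 else 0 := by
  have hpos : P.chains.bdPart .pos n c G = P.chains.bd n c G ⊔ 0 := rfl
  have hneg : P.chains.bdPart .neg n c G = -P.chains.bd n c G ⊔ 0 := rfl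
  cases s
  · rw [hneg, h, Frame.incidence, PM.sign]
    by_cases h1 : P.frame.IsExtremal (-1) F (P.cell G)
    · have h2 : ¬ P.frame.IsExtremal 1 F (P.cell G) := fun h2 => h2.not_neg h1
      simp [h1, h2]
    · split_ifs <;> simp
  · rw [hpos, h, Frame.incidence, PM.sign]
    by_cases h1 : P.frame.IsExtremal 1 F (P.cell G)
    · simp [h1, h1.not_neg]
    · split_ifs <;> simp

theorem bdPart_single_ne_zero (s : PM) {n : ℕ} (F : P.chains.basis (n + 1))
    (G : P.chains.basis n) : P.chains.bdPart s n (Finsupp.single F 1) G ≠ 0 ↔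
      P.frame.IsExtremal s.sign (P.cell F) (P.cell G) := by
  classical
  rw [bdPart_apply s (P.bd_single_apply F G)]
  exact ite_one_zero_ne_zero _

open Classical in
-- The telescoping along a boundary path of the polygon around `G`; the right side does not depend
-- on which path `s` selects.
theorem sum_isExtremal_mul_incidence (s : PM) {k n : ℕ} (hk : k + 1 < n) (F : P.chains.basis n)
    (G : P.chains.basis k) :
    ∑ E : P.chains.basis (k + 1),
      (if P.frame.IsExtremal s.sign (P.cell F) (P.cell E) then 1 else 0) *
        P.frame.incidence (P.cell E) (P.cell G) = P.frame.incidence (P.cell F) (P.cell G) := by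
  have hP := P.isPolytope_of_isFace (P.isFace_cell F)
  have hB := P.isAdmissible_of_isFace (P.isFace_cell F)
  have hFG : polyDim (P.cell G) + 1 < polyDim (P.cell F) := by
    rw [P.polyDim_cell, P.polyDim_cell]
    exact hk
  have hdim : ∀ E : P.chains.basis (k + 1), polyDim (P.cell E) = polyDim (P.cell G) + 1 :=
    fun E => by rw [P.polyDim_cell, P.polyDim_cell]
  -- The sum counts the edges of the path having `G` as their end of sign `r`: at most one, and one
  -- unless `G` is the end of sign `-r` of the whole path.
  have hsum : ∀ r : ℝ, r * r = 1 → ∑ E : P.chains.basis (k + 1),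
      (if P.frame.IsExtremal s.sign (P.cell F) (P.cell E) then (1 : ℤ) else 0) *
        (if P.frame.IsExtremal r (P.cell E) (P.cell G) then 1 else 0) =
        if IsFace (P.cell F) (P.cell G) ∧ P.frame.IsBoundaryVertex s.sign (P.cell F) (P.cell G) ∧
          ¬ P.frame.IsExtremal (-r) (P.cell F) (P.cell G) then 1 else 0 := by
    intro r hr
    have hmul : ∀ E : P.chains.basis (k + 1),
        (if P.frame.IsExtremal s.sign (P.cell F) (P.cell E) then (1 : ℤ) else 0) *
          (if P.frame.IsExtremal r (P.cell E) (P.cell G) then 1 else 0) =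
          if P.frame.IsExtremal s.sign (P.cell F) (P.cell E) ∧
            P.frame.IsExtremal r (P.cell E) (P.cell G) then 1 else 0 := by
      intro E
      rw [ite_and]
      split_ifs <;> simp
    rw [Finset.sum_congr rfl fun E _ => hmul E, sum_ite_of_unique]
    · refine if_congr ⟨?_, ?_⟩ rfl rfl
      · rintro ⟨E, hE, hEG⟩
        have hG := hE.1.trans hP hEG.1
        exact ⟨hG, (hB.exists_isExtremal_iff hP hG hFG s.sign_mul_self hr).1
          ⟨P.cell E, hdim E, hE, hEG⟩⟩
      · rintro ⟨hG, h⟩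
        obtain ⟨E, hE, h2, h3⟩ :=
          (hB.exists_isExtremal_iff hP hG hFG s.sign_mul_self hr).2 h
        obtain ⟨E, rfl⟩ := P.exists_cell_eq (n := k + 1) ((P.isFace_cell F).trans P.isPolytope h2.1)
          (by rw [hE, P.polyDim_cell])
        exact ⟨E, h2, h3⟩
    · rintro E E' ⟨h2, h3⟩ ⟨h2', h3'⟩
      exact P.cell_injective (hB.isExtremal_unique hP s.sign_mul_self hr (hdim E) h2 h3
        (hdim E') h2' h3')
  simp only [Frame.incidence, mul_sub, Finset.sum_sub_distrib]
  rw [hsum 1 (by norm_num), hsum (-1) (by norm_num), neg_neg]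
  by_cases h1 : P.frame.IsExtremal 1 (P.cell F) (P.cell G)
  · simp [h1, h1.not_neg, h1.1, h1.isBoundaryVertex hP hB]
  · by_cases h2 : P.frame.IsExtremal (-1) (P.cell F) (P.cell G)
    · simp [h1, h2, h2.1, h2.isBoundaryVertex hP hB]
    · simp [h1, h2]

open Classical in
theorem atom_single_apply (s : PM) {n : ℕ} (F : P.chains.basis n) {k : ℕ} (hk : k < n)
    (G : P.chains.basis k) : P.chains.atom s (Finsupp.single F 1) hk.le G =
      if P.frame.IsExtremal s.sign (P.cell F) (P.cell G) then 1 else 0 := by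
  -- Induction on the codimension minus one: in codimension zero the atom is the basis element
  -- itself, which is not covered by extremality.
  obtain ⟨j, hj⟩ : ∃ j, k + j + 1 = n := ⟨n - k - 1, by omega⟩
  induction j generalizing k with
  | zero =>
    subst hj
    rw [BasedAugmentedData.atom_of_lt _ _ _ hk]
    refine bdPart_apply s ?_
    rw [show P.chains.atom s (Finsupp.single F 1) (Nat.succ_le_of_lt hk) = Finsupp.single F 1
      from BasedAugmentedData.atom_self _ _ _]
    exact P.bd_single_apply F G
  | succ j ih =>
    rw [BasedAugmentedData.atom_of_lt _ _ _ hk]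
    refine bdPart_apply s ?_
    have hk' : k + 1 < n := by omega
    rw [bd_apply, ← sum_isExtremal_mul_incidence s hk' F G]
    exact Finset.sum_congr rfl fun E _ => congrArg (· * _) (ih hk' E (by omega))

open Classical in
theorem sum_vertices (s : PM) {n : ℕ} (F : P.chains.basis n) (hn : 0 < n) :
    ∑ E : P.chains.basis 0,
      (if P.frame.IsExtremal s.sign (P.cell F) (P.cell E) then (1 : ℤ) else 0) = 1 := by
  obtain ⟨E, ⟨h0, hE⟩, huniq⟩ :=
    (P.isAdmissible_of_isFace (P.isFace_cell F)).existsUnique_vertex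
      (P.isPolytope_of_isFace (P.isFace_cell F)) (by rw [P.polyDim_cell]; exact hn) s.sign_ne_zero
  rw [sum_ite_of_unique, if_pos]
  · obtain ⟨E, rfl⟩ := P.exists_cell_eq ((P.isFace_cell F).trans P.isPolytope hE.1) h0
    exact ⟨E, hE⟩
  · intro E₁ E₂ h₁ h₂
    exact P.cell_injective
      ((huniq _ ⟨P.polyDim_cell E₁, h₁⟩).trans (huniq _ ⟨P.polyDim_cell E₂, h₂⟩).symm)

variable (P)

/-- The target and source halves of `∂ F` have the same boundary, and in degree one each consists of
a single vertex. -/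
theorem isComplex_chains : P.chains.IsComplex := by
  classical
  refine ⟨fun n => ?_, ?_, P.aug_single⟩
  · refine Finsupp.lhom_ext' fun F => LinearMap.ext_ring (Finsupp.ext fun G => ?_)
    change P.chains.bd n (P.chains.bd (n + 1) (Finsupp.single F 1)) G = 0
    rw [bd_apply]
    have hpos := sum_isExtremal_mul_incidence .pos (show n + 1 < n + 2 by omega) F G
    have hneg := sum_isExtremal_mul_incidence .neg (show n + 1 < n + 2 by omega) F G
    rw [← sub_eq_zero.2 (hpos.trans hneg.symm), ← Finset.sum_sub_distrib]
    refine Finset.sum_congr rfl fun E _ => ?_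
    rw [← sub_mul, bd_single_apply]
    rfl
  · refine Finsupp.lhom_ext' fun F => LinearMap.ext_ring ?_
    change P.chains.aug (P.chains.bd 0 (Finsupp.single F 1)) = 0
    rw [aug_apply, ← sub_eq_zero.2
      ((sum_vertices .pos F Nat.one_pos).trans (sum_vertices .neg F Nat.one_pos).symm),
      ← Finset.sum_sub_distrib]
    exact Finset.sum_congr rfl fun E _ => P.bd_single_apply F E

theorem isUnital_chains : P.chains.IsUnital := by
  classical
  intro n F s
  rcases Nat.eq_zero_or_pos n with rfl | hn
  · rw [BasedAugmentedData.atom_self]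
    exact P.aug_single F
  · rw [aug_apply]
    refine Eq.trans ?_ (sum_vertices s F hn)
    exact Finset.sum_congr rfl fun E _ => atom_single_apply s F hn E

end FramedPolytope

/-! ## Loops -/

section Relations

open Relation

variable {α : Type*} {R : α → α → Prop}

/-- A cycle of length at least two collapses under antisymmetry to a reflexive instance of `R`,
which is excluded. -/
theorem transGen_antisymm_iff (hR : ∀ a, ¬ R a a) :
    (∀ a b, TransGen R a b → TransGen R b a → a = b) ↔ ∀ a, ¬ TransGen R a a := by
  refine ⟨fun h a ha => ?_, fun h a b hab hba => absurd (hab.trans hba) (h a)⟩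
  rcases ha with ha | ⟨hab, hba⟩
  · exact hR a ha
  · obtain rfl := h _ _ hab (.single hba)
    exact hR _ hba

theorem nodup_of_isChain (h : ∀ a, ¬ TransGen R a a) {l : List α} (hl : l.IsChain R) :
    l.Nodup := by
  have h1 : l.IsChain (TransGen R) := hl.imp fun _ _ => TransGen.single
  refine (List.isChain_iff_pairwise.1 h1).imp ?_
  rintro a _ hab rfl
  exact h a hab

theorem exists_isChain_of_transGen {a : α} (h : TransGen R a a) :
    ∃ b l, (a :: b :: l).IsChain R ∧ ¬ (a :: b :: l).Nodup := by
  obtain ⟨b, hab, hba⟩ := TransGen.head'_iff.1 h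
  obtain ⟨l, hl, hlast⟩ := List.exists_isChain_cons_of_relationReflTransGen hba
  refine ⟨b, l, List.isChain_cons_cons.2 ⟨hab, hl⟩, fun hn => ?_⟩
  exact (List.nodup_cons.1 hn).1 (hlast ▸ List.getLast_mem _)

/-- In a chain with at least two members each one takes part in an instance of `R`, so the dimension
bound in the definition of a string is automatic for loops. -/
theorem forall_mem_of_isChain {q : α → Prop} (hq : ∀ a b, R a b → q a ∧ q b) :
    ∀ {a b : α} {l : List α}, (a :: b :: l).IsChain R → ∀ x ∈ a :: b :: l, q x
  | a, b, [], h, x, hx => by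
    have := hq a b (List.isChain_cons_cons.1 h).1
    simp only [List.mem_cons, List.not_mem_nil, or_false] at hx
    rcases hx with rfl | rfl
    exacts [this.1, this.2]
  | a, b, c :: l, h, x, hx => by
    obtain ⟨hab, hl⟩ := List.isChain_cons_cons.1 h
    rcases List.mem_cons.1 hx with rfl | hx
    · exact (hq _ _ hab).1
    · exact forall_mem_of_isChain hq hl x hx

end Relations

/-! ### Strings of faces and the precedence relations of the basis -/

namespace FramedPolytope

open Relation

variable {d : ℕ} (P : FramedPolytope d)

/-- The relation between consecutive faces of a cellular `k`-string. -/
def stringRel (k : ℕ) (F G : P.Face) : Prop :=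
  ∃ E, P.frame.IsKTarget k F.1 E ∧ P.frame.IsKSource k G.1 E

/-- The relation between consecutive faces of an inhomogeneous cellular string. -/
def inhomogeneousRel (F G : P.Face) : Prop :=
  IsSource P.frame.orient G.1 F.1 ∨ IsTarget P.frame.orient F.1 G.1

variable {P}

theorem stringRel_iff {k : ℕ} {F G : P.Face} : P.stringRel k F G ↔
    ∃ E : P.chains.basis k,
      P.frame.IsExtremal 1 F.1 (P.cell E) ∧ P.frame.IsExtremal (-1) G.1 (P.cell E) := by
  simp only [stringRel, (P.isAdmissible_of_isFace F.2).isKTarget_iff,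
    (P.isAdmissible_of_isFace G.2).isKSource_iff]
  constructor
  · rintro ⟨E, ⟨h0, h1⟩, -, h2⟩
    obtain ⟨E, rfl⟩ := P.exists_cell_eq (F.2.trans P.isPolytope h1.1) h0
    exact ⟨E, h1, h2⟩
  · rintro ⟨E, h1, h2⟩
    exact ⟨P.cell E, ⟨P.polyDim_cell E, h1⟩, P.polyDim_cell E, h2⟩

theorem lt_polyDim_of_stringRel {k : ℕ} (F G : P.Face) (h : P.stringRel k F G) :
    k < polyDim F.1 ∧ k < polyDim G.1 := by
  obtain ⟨E, h1, h2⟩ := stringRel_iff.1 h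
  rw [← P.polyDim_cell E]
  exact ⟨h1.2.1, h2.2.1⟩

theorem inhomogeneousRel_iff {F G : P.Face} : P.inhomogeneousRel F G ↔
    (polyDim G.1 = polyDim F.1 + 1 ∧ P.frame.IsExtremal (-1) G.1 F.1) ∨
      (polyDim F.1 = polyDim G.1 + 1 ∧ P.frame.IsExtremal 1 F.1 G.1) := by
  rw [inhomogeneousRel, (P.isAdmissible_of_isFace F.2).isTarget_iff,
    (P.isAdmissible_of_isFace G.2).isSource_iff]

theorem exists_cellularLoop_iff {k : ℕ} :
    (∃ l, P.IsCellularLoop k l) ↔ ∃ F, TransGen (P.stringRel k) F F := by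
  constructor
  · rintro ⟨l, ⟨-, hl⟩, hn⟩
    by_contra! h
    exact hn (nodup_of_isChain h hl)
  · rintro ⟨F, hF⟩
    obtain ⟨G, l, hl, hn⟩ := exists_isChain_of_transGen hF
    exact ⟨_, ⟨forall_mem_of_isChain lt_polyDim_of_stringRel hl, hl⟩, hn⟩

theorem exists_inhomogeneousLoop_iff :
    (∃ l, P.IsInhomogeneousLoop l) ↔ ∃ F, TransGen P.inhomogeneousRel F F := by
  constructor
  · rintro ⟨l, hl, hn⟩
    by_contra! h
    exact hn (nodup_of_isChain h hl)
  · rintro ⟨F, hF⟩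
    obtain ⟨G, l, hl, hn⟩ := exists_isChain_of_transGen hF
    exact ⟨_, hl, hn⟩

/-- Intermediate extremal faces, one dimension above `G`, are inserted repeatedly, giving a descent
from `F` to `G` through successive targets. -/
theorem transGen_of_isExtremal_one : ∀ (n : ℕ) {F G : P.Face},
    polyDim F.1 = polyDim G.1 + n → P.frame.IsExtremal 1 F.1 G.1 →
      TransGen P.inhomogeneousRel F G := by
  intro n
  induction n with
  | zero =>
    intro F G hn h
    exact absurd h.2.1 (by omega)
  | succ n ih =>
    intro F G hn h
    rcases Nat.eq_zero_or_pos n with rfl | hpos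
    · exact .single (inhomogeneousRel_iff.2 (Or.inr ⟨hn, h⟩))
    · obtain ⟨E, hE, h1, h2⟩ := h.exists_between (P.isPolytope_of_isFace F.2)
        (P.isAdmissible_of_isFace F.2) (by omega) (by norm_num)
      obtain ⟨E, rfl⟩ : ∃ E' : P.Face, E'.1 = E := ⟨⟨E, F.2.trans P.isPolytope h1.1⟩, rfl⟩
      exact .tail (ih (by omega) h1) (inhomogeneousRel_iff.2 (Or.inr ⟨hE, h2⟩))

theorem transGen_of_isExtremal_neg_one : ∀ (n : ℕ) {F G : P.Face},
    polyDim F.1 = polyDim G.1 + n → P.frame.IsExtremal (-1) F.1 G.1 →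
      TransGen P.inhomogeneousRel G F := by
  intro n
  induction n with
  | zero =>
    intro F G hn h
    exact absurd h.2.1 (by omega)
  | succ n ih =>
    intro F G hn h
    rcases Nat.eq_zero_or_pos n with rfl | hpos
    · exact .single (inhomogeneousRel_iff.2 (Or.inl ⟨hn, h⟩))
    · obtain ⟨E, hE, h1, h2⟩ := h.exists_between (P.isPolytope_of_isFace F.2)
        (P.isAdmissible_of_isFace F.2) (by omega) (by norm_num)
      obtain ⟨E, rfl⟩ : ∃ E' : P.Face, E'.1 = E := ⟨⟨E, F.2.trans P.isPolytope h1.1⟩, rfl⟩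
      exact .head (inhomogeneousRel_iff.2 (Or.inl ⟨hE, h2⟩)) (ih (by omega) h1)

/-- From `F` descend through targets to the common face `E`, then climb through sources to `G`. -/
theorem transGen_of_stringRel {k : ℕ} {F G : P.Face} (h : P.stringRel k F G) :
    TransGen P.inhomogeneousRel F G := by
  obtain ⟨E, h1, h2⟩ := stringRel_iff.1 h
  obtain ⟨E, hE⟩ : ∃ E' : P.Face, E'.1 = P.cell E := ⟨⟨_, P.isFace_cell E⟩, rfl⟩
  rw [← hE] at h1 h2
  exact (transGen_of_isExtremal_one (polyDim F.1 - polyDim E.1)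
    (Nat.add_sub_of_le h1.2.1.le).symm h1).trans
      (transGen_of_isExtremal_neg_one (polyDim G.1 - polyDim E.1)
        (Nat.add_sub_of_le h2.2.1.le).symm h2)

variable (P) in
/-- A basis element of the chain complex, as a face. -/
def toFace (b : Σ n, P.chains.basis n) : P.Face := ⟨P.cell b.2, P.isFace_cell b.2⟩

variable (P) in
theorem exists_toFace_eq (F : P.Face) : ∃ b, P.toFace b = F := by
  obtain ⟨b, hb⟩ := P.exists_cell_eq F.2 rfl
  exact ⟨⟨_, b⟩, Subtype.ext hb⟩

theorem precK_iff {k : ℕ} (b b' : {b : Σ n, P.chains.basis n // k < b.1}) :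
    P.chains.precK k b b' ↔ P.stringRel k (P.toFace b.1) (P.toFace b'.1) := by
  classical
  rw [stringRel_iff]
  refine exists_congr fun E => and_congr ?_ ?_
  · rw [atom_single_apply .pos b.1.2 b.2 E]
    exact ite_one_zero_ne_zero _
  · rw [atom_single_apply .neg b'.1.2 b'.2 E]
    exact ite_one_zero_ne_zero _

theorem prec_iff (b b' : Σ n, P.chains.basis n) :
    P.chains.prec b b' ↔ P.inhomogeneousRel (P.toFace b) (P.toFace b') := by
  have hdim : ∀ b, polyDim (P.toFace b).1 = b.1 := fun b => P.polyDim_cell b.2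
  rw [inhomogeneousRel_iff, hdim, hdim]
  constructor
  · rintro (⟨F, G, h⟩ | ⟨G, F, h⟩)
    · exact Or.inl ⟨rfl, (bdPart_single_ne_zero .neg G F).1 h⟩
    · exact Or.inr ⟨rfl, (bdPart_single_ne_zero .pos G F).1 h⟩
  · obtain ⟨n, F⟩ := b
    obtain ⟨m, G⟩ := b'
    rintro (⟨rfl, h⟩ | ⟨rfl, h⟩)
    · exact .neg F G ((bdPart_single_ne_zero .neg G F).2 h)
    · exact .pos F G ((bdPart_single_ne_zero .pos F G).2 h)

variable (P) in
/-- A face, as a basis element of the chain complex. -/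
noncomputable def ofFace (F : P.Face) : Σ n, P.chains.basis n := (P.exists_toFace_eq F).choose

theorem toFace_ofFace (F : P.Face) : P.toFace (P.ofFace F) = F := (P.exists_toFace_eq F).choose_spec

theorem fst_ofFace (F : P.Face) : (P.ofFace F).1 = polyDim F.1 := by
  conv_rhs => rw [← toFace_ofFace F]
  exact (P.polyDim_cell _).symm

theorem isLoopFree_iff : P.chains.IsLoopFree ↔ ¬ ∃ k l, P.IsCellularLoop k l := by
  rw [not_exists]
  refine forall_congr' fun k => ?_
  rw [exists_cellularLoop_iff, not_exists]
  refine (transGen_antisymm_iff fun b hb => ?_).trans ⟨fun h F hF => ?_, fun h b hb => ?_⟩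
  · obtain ⟨E, h1, h2⟩ := stringRel_iff.1 ((precK_iff _ _).1 hb)
    exact h1.not_neg h2
  · have key : ∀ G, TransGen (P.stringRel k) F G → ∃ hF hG,
        TransGen (P.chains.precK k) ⟨P.ofFace F, hF⟩ ⟨P.ofFace G, hG⟩ := by
      have hprec : ∀ {F G : P.Face}, P.stringRel k F G → ∃ hF hG,
          P.chains.precK k ⟨P.ofFace F, hF⟩ ⟨P.ofFace G, hG⟩ := by
        intro F G hFG
        have := lt_polyDim_of_stringRel _ _ hFG
        refine ⟨by rw [fst_ofFace]; exact this.1, by rw [fst_ofFace]; exact this.2, ?_⟩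
        rw [precK_iff, toFace_ofFace, toFace_ofFace]
        exact hFG
      intro G hG
      induction hG with
      | single h =>
        obtain ⟨h1, h2, h3⟩ := hprec h
        exact ⟨h1, h2, .single h3⟩
      | tail _ h ih =>
        obtain ⟨h1, h2, h3⟩ := ih
        obtain ⟨_, h5, h6⟩ := hprec h
        exact ⟨h1, h5, h3.tail h6⟩
    obtain ⟨_, _, h3⟩ := key F hF
    exact h _ h3
  · exact h _ (hb.lift (fun b => P.toFace b.1) fun b b' => (precK_iff b b').1)

theorem isStronglyLoopFree_iff :
    P.chains.IsStronglyLoopFree ↔ ¬ ∃ l, P.IsInhomogeneousLoop l := by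
  rw [exists_inhomogeneousLoop_iff, not_exists]
  refine (transGen_antisymm_iff fun b hb => ?_).trans ⟨fun h F hF => ?_, fun h b hb => ?_⟩
  · rcases inhomogeneousRel_iff.1 ((prec_iff _ _).1 hb) with h | h
    all_goals exact absurd h.1 (by omega)
  · exact h _ (hF.lift P.ofFace fun F G hFG => by
      change P.chains.prec _ _
      rwa [prec_iff, toFace_ofFace, toFace_ofFace])
  · exact h _ (hb.lift P.toFace fun b b' => (prec_iff b b').1)

theorem not_cellularLoop (h : ¬ ∃ l, P.IsInhomogeneousLoop l) :
    ¬ ∃ k l, P.IsCellularLoop k l := by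
  rintro ⟨k, hl⟩
  rw [exists_cellularLoop_iff] at hl
  obtain ⟨F, hF⟩ := hl
  exact h (exists_inhomogeneousLoop_iff.2 ⟨F, hF.lift' id fun _ _ => transGen_of_stringRel⟩)

end FramedPolytope

theorem mainTheorem1 {d : ℕ} (P : FramedPolytope d) :
    P.chains.IsComplex ∧ P.chains.IsUnital ∧
      (P.chains.IsSteinerDiagram ↔ ¬ ∃ k l, P.IsCellularLoop k l) ∧
      (P.chains.IsStrongSteinerDiagram ↔ ¬ ∃ l, P.IsInhomogeneousLoop l) := by
  have h1 : P.chains.IsSteinerDiagram ↔ ¬ ∃ k l, P.IsCellularLoop k l := by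
    rw [← FramedPolytope.isLoopFree_iff]
    exact ⟨fun h => h.2.2, fun h => ⟨P.isComplex_chains, P.isUnital_chains, h⟩⟩
  refine ⟨P.isComplex_chains, P.isUnital_chains, h1, ?_⟩
  rw [BasedAugmentedData.IsStrongSteinerDiagram, h1, FramedPolytope.isStronglyLoopFree_iff]
  exact ⟨fun h => h.2, fun h => ⟨FramedPolytope.not_cellularLoop h, h⟩⟩
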